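/- **Network.** The typical user is at the origin of the ground plane. Terrestrial base stations (TBSs) are at altitude $H_{\mathrm b}>0$ and form a homogeneous Poisson point process of density $\lambda_{\mathrm b}$; independently, UAVs are at altitude $H_{\mathrm u}>0$ and form a homogeneous Poisson point process of density $\lambda_{\mathrm u}>0$. Given the positions, a UAV at (three-dimensional) distance $r$ from the user is, independently of all else, in line of sight (LoS, tier $\mathrm L$) with probability $p_{\mathrm L}(r)=\big(1+\mu_a\exp\{-\mu_b[\frac{180}{\pi}\arcsin(H_{\mathrm u}/r)-\mu_a]\}\big)^{-1}$, $\mu_a,\mu_b>0$, and otherwise NLoS (tier $\mathrm N$), with probability $p_{\mathrm N}=1-p_{\mathrm L}$. TBSs form tier $\mathrm b$; $\Phi_k$ is the point process of tier $k\in\mathcal K=\{\mathrm b,\mathrm L,\mathrm N\}$; $P_{\mathrm L}=P_{\mathrm N}=P_{\mathrm u}$ and $H_{\mathrm L}=H_{\mathrm N}=H_{\mathrm u}$. A link of tier $k$ has path loss $\kappa_k r^{-\alpha_k}$ with $\kappa_k,\alpha_k>0$, and independent fading $\mathsf H\sim\mathrm{Gamma}(\mathsf M_k,1/\mathsf M_k)$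 (shape, scale), with $\mathsf M_k>0$ and $\mathsf M_{\mathrm b}=1$. At angle $\theta$ off the boresight the antenna gain is $G_j(\theta)=G_{\mathrm M,j}10^{-\min\{12(\theta/\vartheta_j)^2,\mu_{\mathrm{SLA}}\}}$, $j\in\{\mathrm b,\mathrm u\}$, with $G_{\mathrm M,j},\vartheta_j>0$ and $\mu_{\mathrm{SLA}}\ge 0$. Transmit powers $P_{\mathrm b},P_{\mathrm u}$ are positive. Let $\varsigma\in\{\mathrm{SA},\mathrm{VA}\}$ (steerable or vertical UAV antennas). The average power received from a serving transmitter at distance $r$ is $l_{\mathrm b}(r)=P_{\mathrm b}G_{\mathrm b}(\arccos(H_{\mathrm b}/r))\kappa_{\mathrm b}r^{-\alpha_{\mathrm b}}$ and, for $k\in\{\mathrm L,\mathrm N\}$, $l_k(r)=P_{\mathrm u}g(r)\kappa_k r^{-\alpha_k}$ with $g(r)=G_{\mathrm u}(0)$ if $\varsigma=\mathrm{SA}$ and $g(r)=G_{\mathrm u}(\arccos(H_{\mathrm u}/r))$ if $\varsigma=\mathrm{VA}$. The user is served by the transmitter $X^\star$ of strongest average received power, and $A_k=\mathbb P(X^\star\in\Phi_k)$.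 Let $\chi_{k,\ell}(r)=\inf\{x\ge H_\ell: l_\ell(x)\le l_k(r)\}$, i.e. the inverse of the decreasing function $l_\ell$ on $[H_\ell,\infty)$ at $l_k(r)$, equal to $H_\ell$ when $l_k(r)\ge l_\ell(H_\ell)$. If $X^\star\in\Phi_k$, then $\mathrm{SINR}=l_k(\|X^\star\|)\mathsf H_{X^\star}/(N_0+I)$, where $\|X\|$ is the distance of $X$ from the user, $N_0\ge 0$, and $I$ is the sum over all other transmitters $X$, of any tier $\ell$, of $P_\ell G_X\mathsf H_X\kappa_\ell\|X\|^{-\alpha_\ell}$. Here $G_X=G_{\mathrm b}(\arccos(H_{\mathrm b}/\|X\|))$ for a TBS and $G_X=G_{\mathrm u}(\arccos(H_{\mathrm u}/\|X\|))$ for a UAV if $\varsigma=\mathrm{VA}$. If $\varsigma=\mathrm{SA}$, each interfering UAV points at its own ground user, so $G_X=G_{\mathrm u}(\Theta)$ with $\cos\Theta=\frac{H_{\mathrm u}^2-Lt\cos a}{\sqrt{(H_{\mathrm u}^2+L^2)(H_{\mathrm u}^2+t^2)}}$, where $L$ is the horizontal distance of the UAV from the typical user, $a$ is uniform on $[0,2\pi]$,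 and $t$ has the law of the horizontal distance between the typical user and $X^\star$ given that $X^\star$ is a UAV, all independent. Let $M_{b|k}(\gamma)=\mathbb E\big[\mathbb P(\mathrm{SINR}>\gamma\mid\Phi_{\mathrm b},\Phi_{\mathrm L},\Phi_{\mathrm N})^b\,\big|\,X^\star\in\Phi_k\big]$. **Statement.** For both $\varsigma$, as $\lambda_{\mathrm b}\to\infty$ with all other parameters fixed: 1. $$\lim_{\lambda_{\mathrm b}\to\infty}A_{\mathrm b}=\exp\Big\{-2\pi\lambda_{\mathrm u}\Big[\int_{H_{\mathrm u}}^{\chi_{\mathrm b,\mathrm L}(H_{\mathrm b})}p_{\mathrm L}(x)x\,\mathrm dx+\int_{H_{\mathrm u}}^{\chi_{\mathrm b,\mathrm N}(H_{\mathrm b})}p_{\mathrm N}(x)x\,\mathrm dx\Big]\Big\}.$$ 2. $\lim_{\lambda_{\mathrm b}\to\infty}M_{b|k}(\gamma)=0$ for every $\gamma>0$, every integer $b\ge 1$ and every $k\in\mathcal K$. 3. If $P_{\mathrm b}G_{\mathrm M,\mathrm b}\kappa_{\mathrm b}H_{\mathrm b}^{-\alpha_{\mathrm b}}\ge P_{\mathrm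 u}G_{\mathrm M,\mathrm u}\kappa_{\mathrm L}H_{\mathrm u}^{-\alpha_{\mathrm L}}$, and the NLoS path loss function does not exceed the LoS one at distance $H_{\mathrm u}$, i.e. $\kappa_{\mathrm N}H_{\mathrm u}^{-\alpha_{\mathrm N}}\le\kappa_{\mathrm L}H_{\mathrm u}^{-\alpha_{\mathrm L}}$, then $\lim_{\lambda_{\mathrm b}\to\infty}A_{\mathrm b}=1$. -/

import Mathlib

open MeasureTheory ProbabilityTheory Filter Topology
open scoped ENNReal NNReal

noncomputable section

namespace UAVNet

/-- The horizontal plane, with its Euclidean norm and Lebesgue measure. -/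
abbrev Plane := EuclideanSpace ℝ (Fin 2)

/-- Link conditions: ground-to-ground `b` (terrestrial base stations, TBSs), air-to-ground
line-of-sight `L` and air-to-ground non-line-of-sight `N` (UAVs). -/
inductive Tier
  | b | L | N
  deriving DecidableEq

instance : Fintype Tier where
  elems := {.b, .L, .N}
  complete := by intro k; cases k <;> simp

/-- UAV antenna scenario: steerable (`SA`) or vertical (`VA`). -/
inductive Antenna
  | SA | VA
  deriving DecidableEq

/-- The deterministic parameters of the network, apart from the TBS density. -/
structure Params where
  /-- altitude of the TBSs -/
  Hb : ℝ
  /-- altitude of the UAVs -/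
  Hu : ℝ
  /-- density of the UAVs -/
  lamU : ℝ
  /-- transmit power of the TBSs -/
  Pb : ℝ
  /-- transmit power of the UAVs -/
  Pu : ℝ
  /-- maximum antenna gain of the TBSs -/
  GMb : ℝ
  /-- maximum antenna gain of the UAVs -/
  GMu : ℝ
  /-- 3 dB beamwidth of the TBSs -/
  bwB : ℝ
  /-- 3 dB beamwidth of the UAVs -/
  bwU : ℝ
  /-- sidelobe attenuation limit -/
  muSLA : ℝ
  /-- first environment parameter of the line-of-sight probability -/
  mua : ℝ
  /-- second environment parameter of the line-of-sight probability -/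
  mub : ℝ
  /-- path-loss intercepts -/
  kap : Tier → ℝ
  /-- path-loss exponents -/
  al : Tier → ℝ
  /-- fading parameters -/
  M : Tier → ℝ
  /-- thermal noise power -/
  N0 : ℝ
  Hb_pos : 0 < Hb
  Hu_pos : 0 < Hu
  lamU_pos : 0 < lamU
  Pb_pos : 0 < Pb
  Pu_pos : 0 < Pu
  GMb_pos : 0 < GMb
  GMu_pos : 0 < GMu
  bwB_pos : 0 < bwB
  bwU_pos : 0 < bwU
  muSLA_nonneg : 0 ≤ muSLA
  mua_pos : 0 < mua
  mub_pos : 0 < mub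
  kap_pos : ∀ k, 0 < kap k
  al_pos : ∀ k, 0 < al k
  M_pos : ∀ k, 0 < M k
  /-- Rayleigh fading on the ground-to-ground links -/
  M_b : M Tier.b = 1
  N0_nonneg : 0 ≤ N0

namespace Params

variable (p : Params)

/-- Altitude of the transmitters of a tier. -/
def alt : Tier → ℝ
  | .b => p.Hb
  | .L => p.Hu
  | .N => p.Hu

/-- Line-of-sight probability of an air-to-ground link of length `r`. -/
def pL (r : ℝ) : ℝ :=
  1 / (1 + p.mua * Real.exp (-p.mub * (180 / Real.pi * Real.arcsin (p.Hu / r) - p.mua)))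

/-- Non-line-of-sight probability of an air-to-ground link of length `r`. -/
def pN (r : ℝ) : ℝ := 1 - p.pL r

/-- Path-loss function of tier `k`. -/
def pathLoss (k : Tier) (r : ℝ) : ℝ := p.kap k * r ^ (-p.al k)

/-- Gain of a TBS antenna at angle `th` off its boresight. -/
def gainB (th : ℝ) : ℝ := p.GMb * (10 : ℝ) ^ (-(min (12 * (th / p.bwB) ^ 2) p.muSLA))

/-- Gain of a UAV antenna at angle `th` off its boresight. -/
def gainU (th : ℝ) : ℝ := p.GMu * (10 : ℝ) ^ (-(min (12 * (th / p.bwU) ^ 2) p.muSLA))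

/-- Gain of the antenna of a serving UAV at distance `r`. -/
def servGainU (s : Antenna) (r : ℝ) : ℝ :=
  match s with
  | .SA => p.gainU 0
  | .VA => p.gainU (Real.arccos (p.Hu / r))

/-- Average power `l_k(r)` received from a serving transmitter of tier `k` at distance `r`. -/
def avgPower (s : Antenna) (k : Tier) (r : ℝ) : ℝ :=
  match k with
  | .b => p.Pb * p.gainB (Real.arccos (p.Hb / r)) * p.pathLoss .b r
  | .L => p.Pu * p.servGainU s r * p.pathLoss .L r
  | .N => p.Pu * p.servGainU s r * p.pathLoss .N r

/-- Inverse of the decreasing function `l_k` on the range `[H_k, ∞)` of possible link distances;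
power levels above `l_k(H_k)` are sent to `H_k`. -/
def invPower (s : Antenna) (k : Tier) (t : ℝ) : ℝ :=
  sInf {r | p.alt k ≤ r ∧ p.avgPower s k r ≤ t}

/-- `χ_{k,j}(r)`, the inverse of `l_j` at `l_k(r)`. -/
def chi (s : Antenna) (k j : Tier) (r : ℝ) : ℝ := p.invPower s j (p.avgPower s k r)

/-- Off-boresight angle, seen from the typical user, of a UAV at horizontal distance `L` that
points its antenna at a ground user at horizontal distance `t` from it, where `a` is the angle
between the horizontal directions from the typical user to the UAV and from the UAV to its user. -/
def offAngle (L t a : ℝ) : ℝ :=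
  Real.arccos ((p.Hu ^ 2 - L * t * Real.cos a) /
    Real.sqrt ((p.Hu ^ 2 + L ^ 2) * (p.Hu ^ 2 + t ^ 2)))

end Params

/-- The point process (random counting measure) carried by an enumeration of random points. -/
def pointMeasure {Ω E : Type*} [MeasurableSpace E] (X : ℕ → Ω → E) (ω : Ω) : Measure E :=
  Measure.sum fun i => Measure.dirac (X i ω)

/-- `Φ` is a Poisson point process with intensity measure `Lam` under `P`: the numbers of points in
disjoint sets are independent, and the number of points in a set of finite intensity is Poisson. -/
structure IsPoisson {Ω E : Type*} [MeasurableSpace Ω] [MeasurableSpace E]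
    (Φ : Ω → Measure E) (Lam : Measure E) (P : Measure Ω) : Prop where
  measurable : Measurable Φ
  count_law : ∀ B : Set E, MeasurableSet B → Lam B ≠ ∞ →
    P.map (fun ω => Φ ω B) =
      (poissonMeasure (Lam B).toNNReal).map (fun n : ℕ => (n : ℝ≥0∞))
  indep : ∀ (n : ℕ) (B : Fin n → Set E), (∀ i, MeasurableSet (B i)) →
    Pairwise (fun i j => Disjoint (B i) (B j)) → iIndepFun (fun i ω => Φ ω (B i)) P

/-- The kinds of random marks: `losU` decides the link condition of a UAV; `fade k` is the fading
gain of a link of condition `k`; `userDist` and `userAngle` give the position of the ground user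
served by a UAV relative to the UAV. -/
inductive MarkKind
  | losU
  | fade (k : Tier)
  | userDist
  | userAngle

/-- Transmitters: `inl i` is the `i`-th TBS and `inr i` the `i`-th UAV. -/
abbrev Tx := ℕ ⊕ ℕ

/-- The random elements of the network: horizontal positions of the TBSs and of the UAVs
(the typical user is at the origin), and the marks of the transmitters. -/
structure Network (Ω : Type*) where
  posB : ℕ → Ω → Plane
  posU : ℕ → Ω → Plane
  mark : MarkKind → Tx → Ω → ℝ

namespace Network

variable {Ω : Type*} (D : Network Ω) (p : Params) (s : Antenna)

/-- Horizontal position of a transmitter. -/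
def pos (x : Tx) (ω : Ω) : Plane :=
  match x with
  | .inl i => D.posB i ω
  | .inr i => D.posU i ω

/-- Horizontal distance from the typical user to a transmitter. -/
def horDist (x : Tx) (ω : Ω) : ℝ := ‖D.pos x ω‖

/-- Distance (link length) from the typical user to a transmitter. -/
def dist (x : Tx) (ω : Ω) : ℝ :=
  match x with
  | .inl _ => Real.sqrt (D.horDist x ω ^ 2 + p.Hb ^ 2)
  | .inr _ => Real.sqrt (D.horDist x ω ^ 2 + p.Hu ^ 2)

open Classical in
/-- Link condition of a transmitter; the link from a UAV at distance `r` is line-of-sight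
when its uniform mark is at most `p_L(r)`. -/
def tier (x : Tx) (ω : Ω) : Tier :=
  match x with
  | .inl _ => .b
  | .inr _ => if D.mark .losU x ω ≤ p.pL (D.dist p x ω) then .L else .N

/-- Average power received from a transmitter if it serves the typical user. -/
def rxPower (x : Tx) (ω : Ω) : ℝ := p.avgPower s (D.tier p x ω) (D.dist p x ω)

/-- The transmitter has the strongest average received power. -/
def IsStrongest (x : Tx) (ω : Ω) : Prop := ∀ y : Tx, D.rxPower p s y ω ≤ D.rxPower p s x ω

open Classical in
/-- The serving transmitter, the arg max of the average received power (ties, and the absence of a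
maximiser, are resolved in a fixed way). -/
def serving (ω : Ω) : Tx :=
  if h : ∃ x, D.IsStrongest p s x ω then Encodable.choose h else Sum.inl 0

/-- The event that the typical user is associated with tier `k`. -/
def assocEvent (k : Tier) : Set Ω := {ω | D.tier p (D.serving p s ω) ω = k}

/-- Fading gain of the link from a transmitter to the typical user. -/
def fading (x : Tx) (ω : Ω) : ℝ := D.mark (.fade (D.tier p x ω)) x ω

/-- Power `P G κ r^{-α}` times fading that a transmitter contributes to the interference. -/
def interfPower (x : Tx) (ω : Ω) : ℝ :=
  match x with
  | .inl _ => p.Pb * p.gainB (Real.arccos (p.Hb / D.dist p x ω)) * D.fading p x ω *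
      p.pathLoss .b (D.dist p x ω)
  | .inr _ =>
      p.Pu *
        (match s with
          | .SA => p.gainU (p.offAngle (D.horDist x ω) (D.mark .userDist x ω)
              (D.mark .userAngle x ω))
          | .VA => p.gainU (Real.arccos (p.Hu / D.dist p x ω))) *
        D.fading p x ω * p.pathLoss (D.tier p x ω) (D.dist p x ω)

open Classical in
/-- Interference from tier `k`: total power of its transmitters other than the serving one. -/
def interference (k : Tier) (ω : Ω) : ℝ≥0∞ :=
  ∑' x : Tx, if D.tier p x ω = k ∧ x ≠ D.serving p s ω then
    ENNReal.ofReal (D.interfPower p s x ω) else 0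

/-- Signal-to-interference-plus-noise ratio of the typical user. -/
def SINR (ω : Ω) : ℝ≥0∞ :=
  ENNReal.ofReal (D.rxPower p s (D.serving p s ω) ω * D.fading p (D.serving p s ω) ω) /
    (ENNReal.ofReal p.N0 + ∑ k : Tier, D.interference p s k ω)

open Classical in
/-- The point process `Φ_k` of the (horizontal positions of the) transmitters of tier `k`. -/
def tierPoints (k : Tier) (ω : Ω) : Measure Plane :=
  Measure.sum fun x : Tx => if D.tier p x ω = k then Measure.dirac (D.pos x ω) else 0

/-- The information contained in the network geometry, i.e. in the point processes `Φ_k`. -/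
@[reducible] def geometry : MeasurableSpace Ω :=
  MeasurableSpace.comap (fun ω k => D.tierPoints p k ω)
    (inferInstance : MeasurableSpace (Tier → Measure Plane))

variable [MeasurableSpace Ω] (P : Measure Ω)

/-- Association probability `A_k`. -/
def assocProb (k : Tier) : ℝ := P.real (D.assocEvent p s k)

/-- Conditional success probability given the network geometry and association with tier `k`:
`ℙ(SINR > γ | Φ, X⋆ ∈ Φ_k)`. -/
def condSuccess (k : Tier) (gam : ℝ) : Ω → ℝ :=
  condExp (D.geometry p) (ProbabilityTheory.cond P (D.assocEvent p s k))
    ({ω | ENNReal.ofReal gam < D.SINR p s ω}.indicator fun _ => (1 : ℝ))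

/-- Conditional moment `M_{n|k}(γ)`: the `n`-th moment of the conditional success probability for a
typical user associated with tier `k`. -/
def condMoment (k : Tier) (gam : ℝ) (n : ℕ) : ℝ :=
  ∫ ω, (D.condSuccess p s P k gam ω) ^ n ∂(ProbabilityTheory.cond P (D.assocEvent p s k))

/-- The random elements `D` follow the law of the network with TBS density `lamB`. -/
structure IsModel (lamB : ℝ) : Prop where
  measurable_posB : ∀ i, Measurable (D.posB i)
  measurable_posU : ∀ i, Measurable (D.posU i)
  measurable_mark : ∀ m x, Measurable (D.mark m x)
  /-- TBSs: homogeneous Poisson process -/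
  poissonB : IsPoisson (pointMeasure D.posB) (ENNReal.ofReal lamB • volume) P
  /-- UAVs: homogeneous Poisson process -/
  poissonU : IsPoisson (pointMeasure D.posU) (ENNReal.ofReal p.lamU • volume) P
  /-- the TBS and UAV processes are independent -/
  indep_pos : IndepFun (fun ω i => D.posB i ω) (fun ω i => D.posU i ω) P
  /-- all marks are independent -/
  indep_marks : iIndepFun (fun (q : MarkKind × Tx) ω => D.mark q.1 q.2 ω) P
  /-- the marks are independent of the positions -/
  indep_pos_marks : IndepFun (fun ω (x : Tx) => D.pos x ω)
    (fun ω (q : MarkKind × Tx) => D.mark q.1 q.2 ω) P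
  losU_law : ∀ x, P.map (D.mark .losU x) = volume.restrict (Set.Icc 0 1)
  /-- normalized gamma fading -/
  fade_law : ∀ k x, P.map (D.mark (.fade k) x) = gammaMeasure (p.M k) (p.M k)
  /-- the horizontal distance from a UAV to its own user is distributed as that of a typical link
  served by a UAV -/
  userDist_law : ∀ x, P.map (D.mark .userDist x) =
    (ProbabilityTheory.cond P (D.assocEvent p s .L ∪ D.assocEvent p s .N)).map
      (fun ω => D.horDist (D.serving p s ω) ω)
  userAngle_law : ∀ x, P.map (D.mark .userAngle x) =
    ProbabilityTheory.cond volume (Set.Icc 0 (2 * Real.pi))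

end Network

end UAVNet

end

/-! Association. No TBS is received with more than `l_b(H_b)`, so a UAV stronger than that almost
surely excludes association with the TBSs. Conversely, once a TBS lies within distance `ε > H_b`,
the user is served by a TBS as soon as every UAV is weaker than `l_b(ε)`; for fixed `ε` such a TBS
is missing with probability vanishing as the density grows. The UAVs, marked by their line-of-sight
variables, form a marked Poisson process, so the probability that none has power above a threshold
is `exp` of minus an explicit area integral (`IsModel.measure_forall_rxPower_notMem`). This integral
does not see the boundary of the threshold and is continuous as `ε ↓ H_b`, which squeezes `A_b` to
the stated limit. In the third claim both integrals run over degenerate intervals.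

Moments. A conditional probability lies in `[0, 1]`, so its moments of order at least one are
bounded by its mean, and it suffices that `P(X⋆ ∈ Φ_k, SINR > γ) ≤ ε P(X⋆ ∈ Φ_k)` eventually, for
each `ε > 0`. The fading of the serving link is independent of the association and exceeds a large
`T` with small probability. If it is at most `T`, coverage forces the total fading gain of the TBSs
in a suitable region to be bounded by a constant. That region has area at least `π`, so by a
Chernoff bound the latter has probability at most a constant times `decay`, exponentially small in
the TBS density.

For TBS service this absolute bound is enough, because `A_b` has a positive limit. For UAV service
`A_k` may tend to zero, so the bound must be relative to the association event
(`IsModel.measure_fadeSum_annulus_le`). Let the best UAV have power `w`. The TBSs stronger than `w`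
and those with power in `[c w, w)` occupy disjoint regions, so the Laplace functional factorizes:
absence of stronger TBSs yields the probability of association, and the annulus of slightly weaker
TBSs yields the factor `decay`. `exists_volume_annulus` makes the area bound uniform in `w`.

All Poisson computations rest on Laplace functionals with values in `[0, ∞]`; the value `∞` of a
test function encodes that a region is empty. -/

noncomputable section

namespace UAVNet

/-! ### The map `t ↦ exp (-t)` on `[0, ∞]` -/

/-- `t ↦ exp (-t)` as a map from `[0, ∞]` to `[0, 1]`. -/
def negExp (t : ℝ≥0∞) : ℝ≥0∞ := EReal.exp (-(t : EReal))

/-- The inverse of `negExp` on `[0, 1]`. -/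
def negLog (z : ℝ≥0∞) : ℝ≥0∞ := (-(ENNReal.log z)).toENNReal

@[simp] lemma negExp_zero : negExp 0 = 1 := by simp [negExp]

@[simp] lemma negExp_top : negExp ∞ = 0 := by simp [negExp]

lemma negExp_add (a b : ℝ≥0∞) : negExp (a + b) = negExp a * negExp b := by
  unfold negExp
  rw [EReal.coe_ennreal_add, EReal.neg_add (by simp) (by simp), sub_eq_add_neg, EReal.exp_add]

lemma negExp_antitone : Antitone negExp := fun a b h => by
  unfold negExp
  exact EReal.exp_monotone (EReal.neg_le_neg_iff.2 (by exact_mod_cast h))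

lemma negExp_le_one (t : ℝ≥0∞) : negExp t ≤ 1 := by
  simpa using negExp_antitone (zero_le (a := t))

lemma negExp_ne_top (t : ℝ≥0∞) : negExp t ≠ ∞ := ne_top_of_le_ne_top (by simp) (negExp_le_one t)

@[fun_prop]
lemma continuous_negExp : Continuous negExp :=
  ENNReal.continuous_exp.comp (continuous_neg.comp continuous_coe_ennreal_ereal)

@[fun_prop]
lemma measurable_negExp : Measurable negExp := continuous_negExp.measurable

lemma negExp_ofReal {x : ℝ} (hx : 0 ≤ x) :
    negExp (ENNReal.ofReal x) = ENNReal.ofReal (Real.exp (-x)) := by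
  rw [negExp, EReal.coe_ennreal_ofReal, max_eq_left hx, ← EReal.coe_neg, EReal.exp_coe]

lemma negExp_negLog {z : ℝ≥0∞} (hz : z ≤ 1) : negExp (negLog z) = z := by
  have : 0 ≤ -(ENNReal.log z) := by
    rw [EReal.le_neg]; simpa using hz
  rw [negExp, negLog, EReal.coe_toENNReal this, neg_neg, ENNReal.exp_log]

@[fun_prop]
lemma measurable_negLog : Measurable negLog :=
  measurable_ereal_toENNReal.comp (continuous_neg.comp ENNReal.continuous_log).measurable

lemma negExp_sum {ι : Type*} (s : Finset ι) (f : ι → ℝ≥0∞) :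
    negExp (∑ i ∈ s, f i) = ∏ i ∈ s, negExp (f i) := by
  classical
  induction s using Finset.induction_on with
  | empty => simp
  | insert a s ha ih => rw [Finset.sum_insert ha, Finset.prod_insert ha, negExp_add, ih]

lemma negExp_mul_natCast (v : ℝ≥0∞) (n : ℕ) : negExp (v * n) = negExp v ^ n := by
  have := negExp_sum (Finset.range n) (fun _ => v)
  simpa [mul_comm] using this

lemma tendsto_prod_negExp (f : ℕ → ℝ≥0∞) :
    Tendsto (fun m => ∏ j ∈ Finset.range m, negExp (f j)) atTop (𝓝 (negExp (∑' j, f j))) := by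
  simp_rw [← negExp_sum]
  exact (continuous_negExp.tendsto _).comp (ENNReal.tendsto_nat_tsum f)

/-! ### The Laplace functional of a Poisson process -/

/-- With `z = exp (-v)` this is the generating function `∑ e^{-r} (r z)^n / n! = e^{-(1-z) r}`; `z =
0` covers `v = ∞`. -/
lemma lintegral_negExp_poissonMeasure (v : ℝ≥0∞) (r : ℝ≥0) :
    ∫⁻ n : ℕ, negExp (v * n) ∂(poissonMeasure r) = negExp ((1 - negExp v) * r) := by
  obtain ⟨z, hz0, hz⟩ : ∃ z : ℝ, 0 ≤ z ∧ negExp v = ENNReal.ofReal z :=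
    ⟨(negExp v).toReal, ENNReal.toReal_nonneg, (ENNReal.ofReal_toReal (negExp_ne_top v)).symm⟩
  have hz1 : z ≤ 1 := by
    have := negExp_le_one v
    rw [hz] at this
    simpa using this
  have hsum : HasSum (fun n : ℕ => Real.exp (-r) * ((r * z) ^ n / n.factorial))
      (Real.exp (-r) * Real.exp (r * z)) := by
    rw [Real.exp_eq_exp_ℝ]
    exact (NormedSpace.expSeries_div_hasSum_exp ((r : ℝ) * z)).mul_left _
  rw [poissonMeasure, lintegral_sum_measure]
  simp_rw [lintegral_smul_measure, lintegral_dirac, negExp_mul_natCast, hz, smul_eq_mul]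
  have : ∀ n : ℕ, ENNReal.ofReal (Real.exp (-r) * r ^ n / n.factorial) * ENNReal.ofReal z ^ n =
      ENNReal.ofReal (Real.exp (-r) * ((r * z) ^ n / n.factorial)) := fun n => by
    rw [← ENNReal.ofReal_pow hz0, ← ENNReal.ofReal_mul (by positivity)]
    congr 1
    rw [mul_pow]; ring
  simp_rw [this]
  rw [← ENNReal.ofReal_tsum_of_nonneg (fun n => by positivity) hsum.summable, hsum.tsum_eq,
    ← Real.exp_add, ← ENNReal.ofReal_one, ← ENNReal.ofReal_sub _ hz0,
    ← ENNReal.ofReal_coe_nnreal, ← ENNReal.ofReal_mul (by linarith),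
    negExp_ofReal (x := (1 - z) * r) (mul_nonneg (by linarith) r.2)]
  congr 2
  ring

lemma lintegral_pointMeasure {Ω E : Type*} [MeasurableSpace E] {X : ℕ → Ω → E}
    {f : E → ℝ≥0∞} (hf : Measurable f) (ω : Ω) :
    ∫⁻ x, f x ∂(pointMeasure X ω) = ∑' i, f (X i ω) := by
  simp only [pointMeasure, lintegral_sum_measure, lintegral_dirac' _ hf]

variable {Ω E : Type*} [MeasurableSpace Ω] [MeasurableSpace E] {P : Measure Ω}

lemma IsPoisson.lintegral_negExp_apply {Φ : Ω → Measure E} {Lam : Measure E}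
    (h : IsPoisson Φ Lam P) {B : Set E} (hB : MeasurableSet B) (v : ℝ≥0∞)
    (hfin : Lam B ≠ ∞) :
    ∫⁻ ω, negExp (v * Φ ω B) ∂P = negExp ((1 - negExp v) * Lam B) := by
  have hm : Measurable fun ω => Φ ω B := (Measure.measurable_coe hB).comp h.measurable
  have hg : Measurable fun t : ℝ≥0∞ => negExp (v * t) := by fun_prop
  calc ∫⁻ ω, negExp (v * Φ ω B) ∂P = ∫⁻ t, negExp (v * t) ∂(P.map fun ω => Φ ω B) :=
        (lintegral_map hg hm).symm
    _ = _ := by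
      rw [h.count_law B hB hfin, lintegral_map hg (by fun_prop),
        lintegral_negExp_poissonMeasure, ENNReal.coe_toNNReal hfin]

/-- The level sets are disjoint, so the counts in them are independent and the expectation splits
into one Poisson transform per level set. -/
lemma IsPoisson.lintegral_negExp_simpleFunc {Φ : Ω → Measure E} {Lam : Measure E}
    [IsProbabilityMeasure P] (h : IsPoisson Φ Lam P) (f : SimpleFunc E ℝ≥0∞)
    (hf : ∀ v, v ≠ 0 → Lam (f ⁻¹' {v}) ≠ ∞) :
    ∫⁻ ω, negExp (∫⁻ x, f x ∂(Φ ω)) ∂P = negExp (∫⁻ x, (1 - negExp (f x)) ∂Lam) := by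
  classical
  let e := f.range.equivFin.symm
  let B : Fin f.range.card → Set E := fun i => f ⁻¹' {(e i : ℝ≥0∞)}
  have hB : ∀ i, MeasurableSet (B i) := fun i => f.measurableSet_preimage _
  have hdisj : Pairwise fun i j => Disjoint (B i) (B j) := fun i j hij =>
    Disjoint.preimage _ (by
      rw [Set.disjoint_singleton]
      exact fun hc => hij (e.injective (Subtype.ext hc)))
  have hind := h.indep _ B hB hdisj
  have hm : ∀ i, Measurable fun ω => Φ ω (B i) :=
    fun i => (Measure.measurable_coe (hB i)).comp h.measurable
  have hs : ∀ g : ℝ≥0∞ → ℝ≥0∞, ∑ v ∈ f.range, g v = ∑ i, g (e i) := fun g => by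
    rw [← Finset.sum_coe_sort f.range g]
    exact (Equiv.sum_comp e fun v => g v).symm
  have h1 : ∀ ω, negExp (∫⁻ x, f x ∂(Φ ω)) =
      ∏ i, negExp ((e i : ℝ≥0∞) * Φ ω (B i)) := fun ω => by
    rw [f.lintegral_eq_lintegral, SimpleFunc.lintegral, hs (fun v => v * Φ ω (f ⁻¹' {v})),
      negExp_sum]
  have h2 : ∫⁻ x, (1 - negExp (f x)) ∂Lam = ∑ i, (1 - negExp (e i)) * Lam (B i) := by
    have := (f.map fun v => 1 - negExp v).lintegral_eq_lintegral Lam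
    rw [SimpleFunc.map_lintegral, hs (fun v => (1 - negExp v) * Lam (f ⁻¹' {v}))] at this
    simpa using this
  simp_rw [h1]
  rw [h2, negExp_sum]
  have h3 := lintegral_prod_eq_prod_lintegral_of_indepFun (μ := P) Finset.univ
    (fun i ω => negExp ((e i : ℝ≥0∞) * Φ ω (B i)))
    (hind.comp (fun i t => negExp ((e i : ℝ≥0∞) * t)) fun i => by fun_prop)
    (fun i => by have := hm i; fun_prop)
  rw [h3]
  refine Finset.prod_congr rfl fun i _ => ?_
  -- The zero level set may have infinite intensity, where `count_law` says nothing, but its factor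
  -- is 1 on both sides.
  by_cases h0 : (e i : ℝ≥0∞) = 0
  · simp [h0]
  · exact h.lintegral_negExp_apply (hB i) _ (hf _ h0)

/-- The Laplace functional of a Poisson process. -/
theorem IsPoisson.lintegral_negExp {Φ : Ω → Measure E} {Lam : Measure E}
    [IsProbabilityMeasure P] (h : IsPoisson Φ Lam P) {f : E → ℝ≥0∞} (hf : Measurable f)
    {K : Set E} (hK : Lam K ≠ ∞) (hfK : ∀ x ∉ K, f x = 0) :
    ∫⁻ ω, negExp (∫⁻ x, f x ∂(Φ ω)) ∂P = negExp (∫⁻ x, (1 - negExp (f x)) ∂Lam) := by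
  -- Simple functions increase to `f`; the expectation converges by domination, the exponent by
  -- monotonicity. Vanishing off `K` gives their nonzero level sets finite intensity.
  let g := SimpleFunc.eapprox f
  have hgm : Monotone g := SimpleFunc.monotone_eapprox f
  have hgle : ∀ n x, g n x ≤ f x := fun n x => by
    rw [← SimpleFunc.iSup_eapprox_apply hf x]
    exact le_iSup (fun n => g n x) n
  have hgt : ∀ x, Tendsto (fun n => g n x) atTop (𝓝 (f x)) := fun x => by
    rw [← SimpleFunc.iSup_eapprox_apply hf x]
    exact tendsto_atTop_iSup fun m n hmn => hgm hmn x
  have hsimple : ∀ n, ∫⁻ ω, negExp (∫⁻ x, g n x ∂(Φ ω)) ∂P =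
      negExp (∫⁻ x, (1 - negExp (g n x)) ∂Lam) := fun n =>
    h.lintegral_negExp_simpleFunc (g n) fun v hv => ne_top_of_le_ne_top hK <|
      measure_mono fun x hx => by
        by_contra hxK
        have := hgle n x
        rw [hfK x hxK] at this
        exact hv (by rw [← show g n x = v from hx]; exact le_antisymm this zero_le)
  have hmeas : ∀ {u : E → ℝ≥0∞}, Measurable u → Measurable fun ω => ∫⁻ x, u x ∂(Φ ω) :=
    fun hu => (Measure.measurable_lintegral hu).comp h.measurable
  refine tendsto_nhds_unique (f := fun n => ∫⁻ ω, negExp (∫⁻ x, g n x ∂(Φ ω)) ∂P) (l := atTop)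
    ?_ ?_
  · refine tendsto_lintegral_of_dominated_convergence (fun _ => 1)
      (fun n => measurable_negExp.comp (hmeas (g n).measurable)) (fun n => ?_) (by simp) ?_
    · exact Eventually.of_forall fun ω => negExp_le_one _
    · refine Eventually.of_forall fun ω => (continuous_negExp.tendsto _).comp ?_
      exact lintegral_tendsto_of_tendsto_of_monotone (fun n => (g n).measurable.aemeasurable)
        (Eventually.of_forall fun x m n hmn => hgm hmn x) (Eventually.of_forall hgt)
  · simp_rw [hsimple]
    refine (continuous_negExp.tendsto _).comp ?_
    refine lintegral_tendsto_of_tendsto_of_monotone (fun n => ?_)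
      (Eventually.of_forall fun x m n hmn => ?_) (Eventually.of_forall fun x => ?_)
    · have := (g n).measurable
      fun_prop
    · exact tsub_le_tsub_left (negExp_antitone (hgm hmn x)) 1
    · exact ENNReal.Tendsto.sub tendsto_const_nhds ((continuous_negExp.tendsto _).comp (hgt x))
        (Or.inl (by simp))

/-- Integration of a function of two independent random elements. -/
lemma lintegral_indepFun {F : Type*} [MeasurableSpace F] [IsProbabilityMeasure P]
    {X : Ω → E} {Y : Ω → F} (hX : Measurable X) (hY : Measurable Y) (h : IndepFun X Y P)
    {f : E → F → ℝ≥0∞} (hf : Measurable (Function.uncurry f)) :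
    ∫⁻ ω, f (X ω) (Y ω) ∂P = ∫⁻ ω, ∫⁻ ω', f (X ω) (Y ω') ∂P ∂P := by
  have h1 : P.map (fun ω => (X ω, Y ω)) = (P.map X).prod (P.map Y) :=
    (indepFun_iff_map_prod_eq_prod_map_map hX.aemeasurable hY.aemeasurable).1 h
  have h2 := lintegral_map (μ := P) hf (hX.prodMk hY)
  have : IsProbabilityMeasure (P.map Y) := Measure.isProbabilityMeasure_map hY.aemeasurable
  have : IsProbabilityMeasure (P.map X) := Measure.isProbabilityMeasure_map hX.aemeasurable
  rw [h1, lintegral_prod _ hf.aemeasurable, lintegral_map hf.lintegral_prod_right' hX] at h2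
  rw [show ∫⁻ ω, f (X ω) (Y ω) ∂P = ∫⁻ ω, Function.uncurry f (X ω, Y ω) ∂P from rfl, ← h2]
  refine lintegral_congr fun ω => ?_
  exact lintegral_map (hf.comp measurable_prodMk_left) hY

/-- The Laplace functional of an independently marked Poisson process. -/
theorem IsPoisson.lintegral_negExp_marked {X : ℕ → Ω → E} {Lam : Measure E}
    [IsProbabilityMeasure P] (h : IsPoisson (pointMeasure X) Lam P) (hX : ∀ i, Measurable (X i))
    {Y : ℕ → Ω → ℝ} (hY : ∀ i, Measurable (Y i)) (hXY : IndepFun (fun ω i => X i ω)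
      (fun ω i => Y i ω) P) (hYi : iIndepFun Y P) {ν : Measure ℝ} [IsProbabilityMeasure ν]
    (hν : ∀ i, P.map (Y i) = ν) {f : E → ℝ → ℝ≥0∞} (hf : Measurable (Function.uncurry f))
    {K : Set E} (hK : Lam K ≠ ∞) (hfK : ∀ x ∉ K, ∀ y, f x y = 0) :
    ∫⁻ ω, negExp (∑' i, f (X i ω) (Y i ω)) ∂P =
      negExp (∫⁻ x, (1 - ∫⁻ y, negExp (f x y) ∂ν) ∂Lam) := by
  have hnf : Measurable (Function.uncurry fun x y => negExp (f x y)) := measurable_negExp.comp hf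
  have hz : Measurable fun x => ∫⁻ y, negExp (f x y) ∂ν := hnf.lintegral_prod_right'
  have hz1 : ∀ x, ∫⁻ y, negExp (f x y) ∂ν ≤ 1 := fun x =>
    (lintegral_mono fun y => negExp_le_one _).trans (by simp)
  -- Averaging `negExp ∘ f` over the mark of a point at `x` gives `negExp (q x)`, which reduces the
  -- claim to the unmarked process with test function `q`.
  let q : E → ℝ≥0∞ := fun x => negLog (∫⁻ y, negExp (f x y) ∂ν)
  have hq : Measurable q := measurable_negLog.comp hz
  have hqe : ∀ x, negExp (q x) = ∫⁻ y, negExp (f x y) ∂ν := fun x => negExp_negLog (hz1 x)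
  have hqK : ∀ x ∉ K, q x = 0 := fun x hx => by
    simp [q, hfK x hx, negLog]
  simp_rw [← hqe]
  rw [← h.lintegral_negExp hq hK hqK]
  simp_rw [lintegral_pointMeasure hq]
  have hfm : Measurable (Function.uncurry fun (x : ℕ → E) (y : ℕ → ℝ) =>
      negExp (∑' i, f (x i) (y i))) := by
    refine measurable_negExp.comp (Measurable.tsum fun i => ?_)
    have : Measurable fun z : (ℕ → E) × (ℕ → ℝ) => (z.1 i, z.2 i) := by fun_prop
    exact hf.comp this
  rw [lintegral_indepFun (f := fun (x : ℕ → E) (y : ℕ → ℝ) => negExp (∑' i, f (x i) (y i)))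
    (measurable_pi_lambda _ hX) (measurable_pi_lambda _ hY) hXY hfm]
  refine lintegral_congr fun ω => ?_
  have hfx : ∀ x, Measurable (f x) := fun x => hf.comp measurable_prodMk_left
  -- With the positions frozen the marks are still independent with law `ν`, so finite products
  -- factor; the infinite product follows by dominated convergence.
  refine tendsto_nhds_unique (f := fun m => ∏ j ∈ Finset.range m, negExp (q (X j ω))) (l := atTop)
    ?_ (tendsto_prod_negExp _)
  have hprod : ∀ m, ∏ j ∈ Finset.range m, negExp (q (X j ω)) =
      ∫⁻ ω', ∏ j ∈ Finset.range m, negExp (f (X j ω) (Y j ω')) ∂P := fun m => by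
    have h3 := lintegral_prod_eq_prod_lintegral_of_indepFun (μ := P) (Finset.range m)
      (fun j ω' => negExp (f (X j ω) (Y j ω')))
      (hYi.comp (fun j y => negExp (f (X j ω) y)) fun j => measurable_negExp.comp (hfx _))
      (fun j => measurable_negExp.comp ((hfx _).comp (hY j)))
    rw [h3]
    refine Finset.prod_congr rfl fun j _ => ?_
    rw [hqe, ← hν j]
    exact lintegral_map (measurable_negExp.comp (hfx _)) (hY j)
  simp_rw [hprod]
  refine tendsto_lintegral_of_dominated_convergence (fun _ => 1) (fun m => ?_) (fun m => ?_)
    (by simp) (Eventually.of_forall fun ω' => tendsto_prod_negExp _)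
  · exact Finset.measurable_fun_prod _ fun j _ => measurable_negExp.comp ((hfx _).comp (hY j))
  · exact Eventually.of_forall fun ω' => Finset.prod_le_one' fun j _ => negExp_le_one _

/-! ### Independence of the sources of randomness -/

lemma iIndep_sumElim {Ω ι κ : Type*} {mΩ : MeasurableSpace Ω} {P : Measure Ω}
    {m₁ : ι → MeasurableSpace Ω} {m₂ : κ → MeasurableSpace Ω} (h₁ : iIndep m₁ P)
    (h₂ : iIndep m₂ P) (h : Indep (⨆ i, m₁ i) (⨆ i, m₂ i) P) :
    iIndep (Sum.elim m₁ m₂) P := by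
  rw [iIndep_iff] at h₁ h₂ ⊢
  rw [Indep_iff] at h
  intro t f hf
  obtain ⟨u, v, rfl⟩ : ∃ (u : Finset ι) (v : Finset κ), t = u.disjSum v :=
    ⟨t.toLeft, t.toRight, t.toLeft_disjSum_toRight.symm⟩
  have hu : ∀ i ∈ u, MeasurableSet[m₁ i] (f (.inl i)) := fun i hi =>
    hf (.inl i) (Finset.inl_mem_disjSum.2 hi)
  have hv : ∀ i ∈ v, MeasurableSet[m₂ i] (f (.inr i)) := fun i hi =>
    hf (.inr i) (Finset.inr_mem_disjSum.2 hi)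
  have hset : ⋂ i ∈ u.disjSum v, f i = (⋂ i ∈ u, f (.inl i)) ∩ ⋂ i ∈ v, f (.inr i) := by
    ext x
    simp
  rw [hset, Finset.prod_disjSum, ← h₁ u hu, ← h₂ v hv]
  exact h _ _
    (Finset.measurableSet_biInter _ fun i hi => le_iSup m₁ i _ (hu i hi))
    (Finset.measurableSet_biInter _ fun i hi => le_iSup m₂ i _ (hv i hi))

lemma iIndep_bool {Ω : Type*} {mΩ : MeasurableSpace Ω} {P : Measure Ω} [IsProbabilityMeasure P]
    {m : Bool → MeasurableSpace Ω} (h : Indep (m false) (m true) P) : iIndep m P := by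
  classical
  rw [iIndep_iff]
  rw [Indep_iff] at h
  intro t f hf
  let g : Bool → Set Ω := fun b => if b ∈ t then f b else Set.univ
  have hg : ∀ b, MeasurableSet[m b] (g b) := fun b => by
    by_cases hb : b ∈ t
    · simpa [g, hb] using hf b hb
    · simp [g, hb]
  have h1 : ⋂ i ∈ t, f i = g false ∩ g true := by
    ext x
    by_cases hf : false ∈ t <;> by_cases ht : true ∈ t <;> simp [g, hf, ht]
  have h2 : ∏ i ∈ t, P (f i) = P (g false) * P (g true) := by
    rw [mul_comm, ← Fintype.prod_bool fun b => P (g b),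
      ← Finset.prod_subset (Finset.subset_univ t) (f := fun b => P (g b))
        (fun b _ hb => by simp [g, hb])]
    exact Finset.prod_congr rfl fun b hb => by simp [g, hb]
  rw [h1, h2]
  exact h _ _ (hg _) (hg _)

lemma comap_pi_le {Ω ι α : Type*} [MeasurableSpace α] {m : MeasurableSpace Ω} {f : Ω → ι → α}
    (h : ∀ i, Measurable[m] fun ω => f ω i) :
    MeasurableSpace.comap f MeasurableSpace.pi ≤ m :=
  (measurable_pi_lambda _ h).comap_le

lemma comap_apply_le {Ω ι α : Type*} [MeasurableSpace α] {f : Ω → ι → α} (i : ι) :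
    MeasurableSpace.comap (fun ω => f ω i) inferInstance ≤
      MeasurableSpace.comap f MeasurableSpace.pi := by
  rintro _ ⟨A, hA, rfl⟩
  exact ⟨(fun x : ι → α => x i) ⁻¹' A, measurable_pi_apply i hA, rfl⟩

/-- The independent sources of randomness of a network: the TBS positions, the UAV positions, and
each of the marks. -/
abbrev Source := Bool ⊕ (MarkKind × Tx)

namespace Network

variable {Ω : Type*} (D : Network Ω)

/-- The `σ`-algebra generated by a source of randomness. -/
@[reducible] def sourceAlg : Source → MeasurableSpace Ω :=
  Sum.elim
    (fun c => MeasurableSpace.comap (fun ω i => bif c then D.posU i ω else D.posB i ω)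
      inferInstance)
    (fun q => MeasurableSpace.comap (D.mark q.1 q.2) inferInstance)

/-- The `σ`-algebra generated by a set of sources of randomness. -/
@[reducible] def infoAlg (S : Set Source) : MeasurableSpace Ω := ⨆ i ∈ S, D.sourceAlg i

variable {D} {S T : Set Source}

lemma sourceAlg_le_infoAlg {i : Source} (hi : i ∈ S) : D.sourceAlg i ≤ D.infoAlg S :=
  le_iSup₂_of_le i hi le_rfl

lemma measurable_posB_infoAlg (h : Sum.inl false ∈ S) (i : ℕ) :
    Measurable[D.infoAlg S] (D.posB i) := by
  have h1 : Measurable[D.sourceAlg (.inl false)] fun ω i => D.posB i ω := fun A hA =>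
    ⟨A, hA, rfl⟩
  exact (measurable_pi_apply i).comp (h1.mono (sourceAlg_le_infoAlg h) le_rfl)

lemma measurable_posU_infoAlg (h : Sum.inl true ∈ S) (i : ℕ) :
    Measurable[D.infoAlg S] (D.posU i) := by
  have h1 : Measurable[D.sourceAlg (.inl true)] fun ω i => D.posU i ω := fun A hA =>
    ⟨A, hA, rfl⟩
  exact (measurable_pi_apply i).comp (h1.mono (sourceAlg_le_infoAlg h) le_rfl)

lemma measurable_mark_infoAlg {m : MarkKind} {x : Tx} (h : Sum.inr (m, x) ∈ S) :
    Measurable[D.infoAlg S] (D.mark m x) := by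
  have h1 : Measurable[D.sourceAlg (.inr (m, x))] (D.mark m x) := fun A hA => ⟨A, hA, rfl⟩
  exact h1.mono (sourceAlg_le_infoAlg h) le_rfl

variable {p : Params} {s : Antenna} [mΩ : MeasurableSpace Ω] {P : Measure Ω}
  {lamB : ℝ}

lemma IsModel.sourceAlg_le (h : D.IsModel p s P lamB) (i : Source) : D.sourceAlg i ≤ mΩ := by
  rcases i with (_ | _) | q
  · exact (measurable_pi_lambda _ h.measurable_posB).comap_le
  · exact (measurable_pi_lambda _ h.measurable_posU).comap_le
  · exact (h.measurable_mark q.1 q.2).comap_le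

lemma IsModel.infoAlg_le (h : D.IsModel p s P lamB) (S : Set Source) : D.infoAlg S ≤ mΩ :=
  iSup₂_le fun i _ => h.sourceAlg_le i

/-- The three independence assumptions of the model merge into one mutual independence, after which
quantities built from disjoint sets of sources are independent. -/
lemma IsModel.iIndep_sourceAlg [IsProbabilityMeasure P] (h : D.IsModel p s P lamB) :
    iIndep D.sourceAlg P := by
  refine iIndep_sumElim (iIndep_bool ?_) ?_ ?_
  · exact h.indep_pos
  · exact h.indep_marks
  · refine indep_of_indep_of_le_left (indep_of_indep_of_le_right h.indep_pos_marks ?_) ?_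
    · exact iSup_le fun q => comap_apply_le (f := fun ω (q : MarkKind × Tx) => D.mark q.1 q.2 ω) q
    · refine iSup_le fun c => ?_
      cases c
      · exact comap_pi_le fun i => Measurable.of_comap_le
          (comap_apply_le (f := fun ω (x : Tx) => D.pos x ω) (.inl i))
      · exact comap_pi_le fun i => Measurable.of_comap_le
          (comap_apply_le (f := fun ω (x : Tx) => D.pos x ω) (.inr i))

lemma IsModel.indep_infoAlg [IsProbabilityMeasure P] (h : D.IsModel p s P lamB)
    (hST : Disjoint S T) : Indep (D.infoAlg S) (D.infoAlg T) P :=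
  indep_iSup_of_disjoint h.sourceAlg_le h.iIndep_sourceAlg hST

lemma IsModel.indepFun [IsProbabilityMeasure P] (h : D.IsModel p s P lamB)
    (hST : Disjoint S T) {α β : Type*} [MeasurableSpace α] [MeasurableSpace β] {f : Ω → α}
    {g : Ω → β} (hf : Measurable[D.infoAlg S] f) (hg : Measurable[D.infoAlg T] g) :
    IndepFun f g P :=
  indep_of_indep_of_le_left (indep_of_indep_of_le_right (h.indep_infoAlg hST) hg.comap_le)
    hf.comap_le

lemma IsModel.iIndepFun_mark (h : D.IsModel p s P lamB) {ι : Type*} {q : ι → MarkKind × Tx}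
    (hq : Function.Injective q) : iIndepFun (fun i => D.mark (q i).1 (q i).2) P :=
  h.indep_marks.precomp hq

end Network

/-! ### Measurability of the association event -/

/-- `Encodable.choose` searches the codes in increasing order, so ties are resolved in favour of the
smallest code. This explicit rule makes the serving transmitter measurable. -/
lemma encode_choose_le {α : Type*} [Denumerable α] {q : α → Prop} [DecidablePred q]
    (h : ∃ x, q x) {y : α} (hy : q y) :
    Encodable.encode (Encodable.choose h) ≤ Encodable.encode y := by
  unfold Encodable.choose Encodable.chooseX
  dsimp only
  split
  rename_i a _ heq _
  rw [Denumerable.decode_eq_ofNat, Option.some_inj] at heq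
  have ha := congrArg Encodable.encode heq
  rw [Denumerable.encode_ofNat] at ha
  change Encodable.encode a ≤ _
  rw [← ha]
  refine @Nat.find_min' ?_ ?_ ?_ ?_ ?_
  rw [Encodable.encodek]
  exact hy

lemma encodable_choose_eq_iff {α : Type*} [Denumerable α] {q : α → Prop} [DecidablePred q]
    (h : ∃ x, q x) (x : α) :
    Encodable.choose h = x ↔ q x ∧ ∀ y, Encodable.encode y < Encodable.encode x → ¬ q y := by
  constructor
  · rintro rfl
    exact ⟨Encodable.choose_spec h, fun y hy hq => absurd (encode_choose_le h hq) (not_le.2 hy)⟩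
  · rintro ⟨hx, hmx⟩
    refine Encodable.encode_injective (le_antisymm (encode_choose_le h hx) ?_)
    by_contra hlt
    exact hmx _ (not_le.1 hlt) (Encodable.choose_spec h)

namespace Params

variable (p : Params)

@[fun_prop]
lemma measurable_pL : Measurable p.pL := by
  unfold pL
  fun_prop

@[fun_prop]
lemma measurable_gainB : Measurable p.gainB := by
  unfold gainB
  fun_prop

@[fun_prop]
lemma measurable_gainU : Measurable p.gainU := by
  unfold gainU
  fun_prop

@[fun_prop]
lemma measurable_pathLoss (k : Tier) : Measurable (p.pathLoss k) := by
  unfold pathLoss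
  fun_prop

@[fun_prop]
lemma measurable_servGainU (s : Antenna) : Measurable (p.servGainU s) := by
  unfold servGainU
  cases s <;> fun_prop

@[fun_prop]
lemma measurable_avgPower (s : Antenna) (k : Tier) : Measurable (p.avgPower s k) := by
  cases k <;> unfold avgPower <;> fun_prop

end Params

namespace Network

variable {Ω : Type*} {D : Network Ω} {p : Params} {s : Antenna}

lemma serving_eq_iff (x : Tx) (ω : Ω) :
    D.serving p s ω = x ↔
      (D.IsStrongest p s x ω ∧
        ∀ y : Tx, Encodable.encode y < Encodable.encode x → ¬ D.IsStrongest p s y ω) ∨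
      ((∀ y, ¬ D.IsStrongest p s y ω) ∧ x = .inl 0) := by
  classical
  unfold serving
  split_ifs with h
  · rw [encodable_choose_eq_iff]
    exact ⟨Or.inl, fun h' => h'.resolve_right fun hc => h.elim fun y hy => hc.1 y hy⟩
  · have h' : ∀ y, ¬ D.IsStrongest p s y ω := fun y hy => h ⟨y, hy⟩
    exact ⟨fun hx => Or.inr ⟨h', hx.symm⟩, fun hx => (hx.resolve_left fun hc => h' x hc.1).2.symm⟩

/-- The event that the typical user is served by a given transmitter through a given tier. -/
def servedBy (D : Network Ω) (p : Params) (s : Antenna) (k : Tier) (x : Tx) : Set Ω :=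
  {ω | D.serving p s ω = x} ∩ {ω | D.tier p x ω = k}

lemma assocEvent_eq_iUnion (k : Tier) : D.assocEvent p s k = ⋃ x, D.servedBy p s k x := by
  ext ω
  simp [assocEvent, servedBy]

lemma pairwise_disjoint_servedBy (k : Tier) :
    Pairwise (Function.onFun Disjoint (D.servedBy p s k)) := fun _ _ hxy =>
  Set.disjoint_left.2 fun _ hx hy => hxy (hx.1.symm.trans hy.1)

variable [MeasurableSpace Ω]

lemma measurable_dist (hB : ∀ i, Measurable (D.posB i)) (hU : ∀ i, Measurable (D.posU i))
    (x : Tx) : Measurable (D.dist p x) := by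
  rcases x with i | i
  · have := hB i
    change Measurable fun ω => Real.sqrt (‖D.posB i ω‖ ^ 2 + p.Hb ^ 2)
    fun_prop
  · have := hU i
    change Measurable fun ω => Real.sqrt (‖D.posU i ω‖ ^ 2 + p.Hu ^ 2)
    fun_prop

lemma measurableSet_tier_inr {i : ℕ} (hU : Measurable (D.posU i))
    (hl : Measurable (D.mark .losU (.inr i))) (k : Tier) :
    MeasurableSet {ω | D.tier p (.inr i) ω = k} := by
  have hd : Measurable (D.dist p (.inr i)) := by
    change Measurable fun ω => Real.sqrt (‖D.posU i ω‖ ^ 2 + p.Hu ^ 2)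
    fun_prop
  have hm : MeasurableSet {ω | D.mark .losU (.inr i) ω ≤ p.pL (D.dist p (.inr i) ω)} :=
    measurableSet_le hl (p.measurable_pL.comp hd)
  have : {ω | D.tier p (.inr i) ω = k} =
      ({ω | D.mark .losU (.inr i) ω ≤ p.pL (D.dist p (.inr i) ω)} ∩ {_ω | Tier.L = k}) ∪
      ({ω | D.mark .losU (.inr i) ω ≤ p.pL (D.dist p (.inr i) ω)}ᶜ ∩ {_ω | Tier.N = k}) := by
    ext ω
    by_cases h : D.mark .losU (.inr i) ω ≤ p.pL (D.dist p (.inr i) ω) <;> simp [tier, h]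
  rw [this]
  exact (hm.inter (.const _)).union (hm.compl.inter (.const _))

lemma measurableSet_tier (hU : ∀ i, Measurable (D.posU i))
    (hl : ∀ i, Measurable (D.mark .losU (.inr i))) (x : Tx) (k : Tier) :
    MeasurableSet {ω | D.tier p x ω = k} := by
  rcases x with i | i
  · simp [tier]
  · exact measurableSet_tier_inr (hU i) (hl i) k

lemma measurable_rxPower (hB : ∀ i, Measurable (D.posB i)) (hU : ∀ i, Measurable (D.posU i))
    (hl : ∀ i, Measurable (D.mark .losU (.inr i))) (x : Tx) : Measurable (D.rxPower p s x) := by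
  have hd := measurable_dist (p := p) hB hU x
  have ht := measurableSet_tier (p := p) hU hl x
  classical
  have : D.rxPower p s x = fun ω =>
      if D.tier p x ω = .b then p.avgPower s .b (D.dist p x ω) else
      if D.tier p x ω = .L then p.avgPower s .L (D.dist p x ω) else
      p.avgPower s .N (D.dist p x ω) := by
    ext ω
    unfold rxPower
    cases D.tier p x ω <;> simp
  rw [this]
  exact Measurable.ite (ht _) (by fun_prop) (Measurable.ite (ht _) (by fun_prop) (by fun_prop))

lemma measurableSet_isStrongest (hB : ∀ i, Measurable (D.posB i))
    (hU : ∀ i, Measurable (D.posU i)) (hl : ∀ i, Measurable (D.mark .losU (.inr i))) (x : Tx) :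
    MeasurableSet {ω | D.IsStrongest p s x ω} := by
  unfold IsStrongest
  rw [Set.ofPred_forall]
  exact MeasurableSet.iInter fun y =>
    measurableSet_le (measurable_rxPower hB hU hl y) (measurable_rxPower hB hU hl x)

lemma measurableSet_serving (hB : ∀ i, Measurable (D.posB i))
    (hU : ∀ i, Measurable (D.posU i)) (hl : ∀ i, Measurable (D.mark .losU (.inr i))) (x : Tx) :
    MeasurableSet {ω | D.serving p s ω = x} := by
  have hS := measurableSet_isStrongest (p := p) (s := s) hB hU hl
  have : {ω | D.serving p s ω = x} = ({ω | D.IsStrongest p s x ω} ∩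
        ⋂ (y : Tx) (_ : Encodable.encode y < Encodable.encode x),
          {ω | D.IsStrongest p s y ω}ᶜ) ∪
      ((⋂ y : Tx, {ω | D.IsStrongest p s y ω}ᶜ) ∩ {_ω | x = .inl 0}) := by
    ext ω
    rw [Set.mem_ofPred, serving_eq_iff]
    simp only [Set.mem_union, Set.mem_inter_iff, Set.mem_iInter, Set.mem_compl_iff,
      Set.mem_ofPred]
  rw [this]
  exact ((hS x).inter (MeasurableSet.iInter fun y => MeasurableSet.iInter fun _ =>
    (hS y).compl)).union ((MeasurableSet.iInter fun y => (hS y).compl).inter (.const _))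

/-- Only positions and line-of-sight marks enter, and `Ω` may carry any `σ`-algebra for which these
are measurable. Applied to the one they generate, this gives independence of association and fading.
-/
lemma measurableSet_servedBy (hB : ∀ i, Measurable (D.posB i))
    (hU : ∀ i, Measurable (D.posU i)) (hl : ∀ i, Measurable (D.mark .losU (.inr i))) (k : Tier)
    (x : Tx) : MeasurableSet (D.servedBy p s k x) :=
  (measurableSet_serving hB hU hl x).inter (measurableSet_tier hU hl x k)

lemma measurableSet_assocEvent (hB : ∀ i, Measurable (D.posB i))
    (hU : ∀ i, Measurable (D.posU i)) (hl : ∀ i, Measurable (D.mark .losU (.inr i))) (k : Tier) :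
    MeasurableSet (D.assocEvent p s k) := by
  rw [assocEvent_eq_iUnion]
  exact MeasurableSet.iUnion fun x => measurableSet_servedBy hB hU hl k x

end Network

/-! ### The average received power as a function of the distance -/

namespace Params

variable (p : Params) (s : Antenna) (k : Tier)

lemma alt_pos : 0 < p.alt k := by
  cases k
  exacts [p.Hb_pos, p.Hu_pos, p.Hu_pos]

/-- The relative gain `10^{-min{12 (θ / ϑ)², μ}}` of an antenna. -/
def relGain (w th : ℝ) : ℝ := (10 : ℝ) ^ (-(min (12 * (th / w) ^ 2) p.muSLA))

lemma continuous_relGain (w : ℝ) : Continuous (p.relGain w) := by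
  unfold relGain
  exact Continuous.rpow (by fun_prop) (by fun_prop) fun _ => Or.inl (by norm_num)

lemma relGain_antitoneOn {w : ℝ} (hw : 0 < w) : AntitoneOn (p.relGain w) (Set.Ici 0) := by
  intro a ha b hb hab
  unfold relGain
  refine Real.rpow_le_rpow_of_exponent_le (by norm_num) ?_
  have h1 : a / w ≤ b / w := by gcongr
  have h2 : 0 ≤ a / w := div_nonneg ha hw.le
  gcongr

lemma relGain_le_one (w th : ℝ) : p.relGain w th ≤ 1 :=
  Real.rpow_le_one_of_one_le_of_nonpos (by norm_num)
    (neg_nonpos.2 (le_min (by positivity) p.muSLA_nonneg))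

lemma le_relGain (w th : ℝ) : (10 : ℝ) ^ (-p.muSLA) ≤ p.relGain w th :=
  Real.rpow_le_rpow_of_exponent_le (by norm_num) (neg_le_neg (min_le_right _ _))

@[simp] lemma relGain_zero (w : ℝ) : p.relGain w 0 = 1 := by
  simp [relGain, p.muSLA_nonneg]

lemma continuousOn_arccos_div (H : ℝ) :
    ContinuousOn (fun r => Real.arccos (H / r)) (Set.Ioi 0) :=
  Real.continuous_arccos.comp_continuousOn
    (continuousOn_const.div continuousOn_id fun _ hr => ne_of_gt hr)

lemma relGain_arccos_antitoneOn {w H : ℝ} (hw : 0 < w) (hH : 0 < H) :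
    AntitoneOn (fun r => p.relGain w (Real.arccos (H / r))) (Set.Ici H) := by
  intro a ha b hb hab
  refine p.relGain_antitoneOn hw (Real.arccos_nonneg _) (Real.arccos_nonneg _) ?_
  have : 0 < a := hH.trans_le ha
  exact Real.arccos_le_arccos (by gcongr)

/-- The average received power is the path loss times a bounded nonincreasing factor. -/
lemma exists_avgPower_eq : ∃ (m C : ℝ) (g : ℝ → ℝ), 0 < m ∧ 0 < C ∧
    (∀ r, p.avgPower s k r = g r * p.pathLoss k r) ∧ (∀ r, m ≤ g r) ∧ (∀ r, g r ≤ C) ∧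
    AntitoneOn g (Set.Ici (p.alt k)) ∧ ContinuousOn g (Set.Ioi 0) := by
  -- The sidelobe limit keeps the relative gain above `10^{-μ}`, and it never exceeds 1; these
  -- bounds produce `m` and `C`.
  have hm : (0 : ℝ) < 10 ^ (-p.muSLA) := by positivity
  have key : ∀ (A : ℝ) (h : ℝ → ℝ), 0 < A → (∀ r, p.avgPower s k r = A * h r * p.pathLoss k r) →
      (∀ r, (10 : ℝ) ^ (-p.muSLA) ≤ h r) → (∀ r, h r ≤ 1) → AntitoneOn h (Set.Ici (p.alt k)) →
      ContinuousOn h (Set.Ioi 0) → ∃ (m C : ℝ) (g : ℝ → ℝ), 0 < m ∧ 0 < C ∧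
    (∀ r, p.avgPower s k r = g r * p.pathLoss k r) ∧ (∀ r, m ≤ g r) ∧ (∀ r, g r ≤ C) ∧
    AntitoneOn g (Set.Ici (p.alt k)) ∧ ContinuousOn g (Set.Ioi 0) :=
    fun A h hA h1 h2 h3 h4 h5 => ⟨A * 10 ^ (-p.muSLA), A, fun r => A * h r, by positivity, hA, h1,
      fun r => mul_le_mul_of_nonneg_left (h2 r) hA.le,
      fun r => mul_le_of_le_one_right hA.le (h3 r),
      fun a ha b hb hab => mul_le_mul_of_nonneg_left (h4 ha hb hab) hA.le,
      continuousOn_const.mul h5⟩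
  have hc : ∀ w H, ContinuousOn (fun r => p.relGain w (Real.arccos (H / r))) (Set.Ioi 0) :=
    fun w H => (p.continuous_relGain w).comp_continuousOn (continuousOn_arccos_div H)
  have hu : ∀ j, j ≠ Tier.b → ∀ A r, A * p.servGainU s r * p.pathLoss j r = A * p.GMu *
      (match s with
        | .SA => p.relGain p.bwU 0
        | .VA => p.relGain p.bwU (Real.arccos (p.Hu / r))) * p.pathLoss j r := by
    intro j _ A r
    cases s <;> simp only [servGainU, gainU, relGain] <;> ring
  have hGu := mul_pos p.Pu_pos p.GMu_pos
  cases k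
  · refine key (p.Pb * p.GMb) (fun r => p.relGain p.bwB (Real.arccos (p.Hb / r)))
      (mul_pos p.Pb_pos p.GMb_pos) (fun r => ?_) (fun r => p.le_relGain _ _)
      (fun r => p.relGain_le_one _ _) (p.relGain_arccos_antitoneOn p.bwB_pos p.Hb_pos) (hc _ _)
    simp only [avgPower, gainB, relGain]
    ring
  · refine key (p.Pu * p.GMu) _ hGu (fun r => hu .L (by simp) p.Pu r) ?_ ?_ ?_ ?_ <;>
      cases s <;> dsimp only
    exacts [fun r => p.le_relGain _ _, fun r => p.le_relGain _ _, fun r => p.relGain_le_one _ _,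
      fun r => p.relGain_le_one _ _, antitone_const.antitoneOn _,
      p.relGain_arccos_antitoneOn p.bwU_pos p.Hu_pos, continuousOn_const, hc _ _]
  · refine key (p.Pu * p.GMu) _ hGu (fun r => hu .N (by simp) p.Pu r) ?_ ?_ ?_ ?_ <;>
      cases s <;> dsimp only
    exacts [fun r => p.le_relGain _ _, fun r => p.le_relGain _ _, fun r => p.relGain_le_one _ _,
      fun r => p.relGain_le_one _ _, antitone_const.antitoneOn _,
      p.relGain_arccos_antitoneOn p.bwU_pos p.Hu_pos, continuousOn_const, hc _ _]

lemma avgPower_b_alt : p.avgPower s .b p.Hb = p.Pb * p.GMb * p.kap .b * p.Hb ^ (-p.al .b) := by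
  have := p.relGain_zero p.bwB
  simp only [relGain] at this
  simp only [avgPower, gainB, pathLoss, div_self p.Hb_pos.ne', Real.arccos_one, this]
  ring

lemma avgPower_u_alt (hk : k ≠ .b) :
    p.avgPower s k p.Hu = p.Pu * p.GMu * p.kap k * p.Hu ^ (-p.al k) := by
  have := p.relGain_zero p.bwU
  simp only [relGain] at this
  cases k
  · exact absurd rfl hk
  all_goals
    cases s <;>
    simp only [avgPower, servGainU, gainU, pathLoss, div_self p.Hu_pos.ne', Real.arccos_one, this]
    <;> ring

lemma pathLoss_pos {r : ℝ} (hr : 0 < r) : 0 < p.pathLoss k r := by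
  have := p.kap_pos k
  unfold pathLoss
  positivity

lemma pathLoss_strictAntiOn : StrictAntiOn (p.pathLoss k) (Set.Ioi 0) := by
  intro a ha b hb hab
  unfold pathLoss
  exact mul_lt_mul_of_pos_left
    (Real.rpow_lt_rpow_of_neg ha hab (neg_neg_iff_pos.2 (p.al_pos k))) (p.kap_pos k)

lemma continuousOn_pathLoss : ContinuousOn (p.pathLoss k) (Set.Ioi 0) := by
  unfold pathLoss
  exact continuousOn_const.mul (continuousOn_id.rpow_const fun r hr => Or.inl (ne_of_gt hr))

lemma avgPower_pos {r : ℝ} (hr : 0 < r) : 0 < p.avgPower s k r := by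
  obtain ⟨m, C, g, hm, -, hg, hmg, -⟩ := p.exists_avgPower_eq s k
  rw [hg]
  exact mul_pos (hm.trans_le (hmg r)) (p.pathLoss_pos k hr)

lemma avgPower_strictAntiOn : StrictAntiOn (p.avgPower s k) (Set.Ici (p.alt k)) := by
  obtain ⟨m, C, g, hm, -, hg, hmg, -, hga, -⟩ := p.exists_avgPower_eq s k
  intro a ha b hb hab
  have ha0 : 0 < a := (p.alt_pos k).trans_le ha
  have hb0 : 0 < b := (p.alt_pos k).trans_le hb
  rw [hg, hg]
  calc g b * p.pathLoss k b < g b * p.pathLoss k a :=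
        mul_lt_mul_of_pos_left (p.pathLoss_strictAntiOn k ha0 hb0 hab) (hm.trans_le (hmg b))
    _ ≤ g a * p.pathLoss k a :=
        mul_le_mul_of_nonneg_right (hga ha hb hab.le) (p.pathLoss_pos k ha0).le

lemma continuousOn_avgPower : ContinuousOn (p.avgPower s k) (Set.Ioi 0) := by
  obtain ⟨m, C, g, -, -, hg, -, -, -, hgc⟩ := p.exists_avgPower_eq s k
  rw [show p.avgPower s k = fun r => g r * p.pathLoss k r from funext hg]
  exact hgc.mul (p.continuousOn_pathLoss k)

lemma tendsto_avgPower : Tendsto (p.avgPower s k) atTop (𝓝 0) := by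
  obtain ⟨m, C, g, hm, -, hg, hmg, hgC, -⟩ := p.exists_avgPower_eq s k
  have h1 : Tendsto (fun r => C * p.pathLoss k r) atTop (𝓝 0) := by
    unfold pathLoss
    simpa using (tendsto_rpow_neg_atTop (p.al_pos k)).const_mul (p.kap k) |>.const_mul C
  refine squeeze_zero' ?_ ?_ h1
  · filter_upwards [eventually_gt_atTop 0] with r hr using (p.avgPower_pos s k hr).le
  · filter_upwards [eventually_gt_atTop 0] with r hr
    rw [hg]
    exact mul_le_mul_of_nonneg_right (hgC r) (p.pathLoss_pos k hr).le

/-- The average received power drops by at most a constant factor over a unit distance. -/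
lemma exists_mul_avgPower_le :
    ∃ c, 0 < c ∧ ∀ r, p.alt k ≤ r → c * p.avgPower s k r ≤ p.avgPower s k (r + 1) := by
  obtain ⟨m, C, g, hm, hC, hg, hmg, hgC, -⟩ := p.exists_avgPower_eq s k
  have hH := p.alt_pos k
  have hd : (0 : ℝ) < (p.alt k + 1) / p.alt k := by positivity
  -- `m / C` bounds the loss of gain; the path loss ratio is smallest at `r = H`, since `(r + 1) / r
  -- ≤ (H + 1) / H`.
  refine ⟨m / C * ((p.alt k + 1) / p.alt k) ^ (-p.al k), by positivity, fun r hr => ?_⟩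
  have hr0 : 0 < r := hH.trans_le hr
  have h1 : p.pathLoss k r * ((p.alt k + 1) / p.alt k) ^ (-p.al k) ≤ p.pathLoss k (r + 1) := by
    unfold pathLoss
    rw [mul_assoc, ← Real.mul_rpow hr0.le hd.le]
    refine mul_le_mul_of_nonneg_left ?_ (p.kap_pos k).le
    refine Real.rpow_le_rpow_of_nonpos (by positivity) ?_ (neg_nonpos.2 (p.al_pos k).le)
    rw [mul_div_assoc', le_div_iff₀ hH]
    nlinarith
  rw [hg, hg]
  have h2 := p.pathLoss_pos k hr0
  have h3 := p.pathLoss_pos k (by linarith : 0 < r + 1)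
  calc m / C * ((p.alt k + 1) / p.alt k) ^ (-p.al k) * (g r * p.pathLoss k r)
      = m * (g r / C) * (p.pathLoss k r * ((p.alt k + 1) / p.alt k) ^ (-p.al k)) := by ring
    _ ≤ m * 1 * (p.pathLoss k r * ((p.alt k + 1) / p.alt k) ^ (-p.al k)) := by
        have : g r / C ≤ 1 := (div_le_one hC).2 (hgC r)
        gcongr
    _ ≤ m * 1 * p.pathLoss k (r + 1) := by gcongr
    _ ≤ g (r + 1) * p.pathLoss k (r + 1) := by
        rw [mul_one]
        exact mul_le_mul_of_nonneg_right (hmg _) h3.le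

/-! ### Inverse of the received power -/

section InvPower

variable {t : ℝ}

/-- The infimum is attained: the set is closed by continuity, and nonempty because the power tends
to 0. -/
lemma invPower_mem (ht : 0 < t) :
    p.alt k ≤ p.invPower s k t ∧ p.avgPower s k (p.invPower s k t) ≤ t := by
  have hne : {r | p.alt k ≤ r ∧ p.avgPower s k r ≤ t}.Nonempty := by
    obtain ⟨r, hr⟩ := ((eventually_ge_atTop (p.alt k)).and
      ((p.tendsto_avgPower s k).eventually (ge_mem_nhds ht))).exists
    exact ⟨r, hr⟩
  have hcl : IsClosed {r | p.alt k ≤ r ∧ p.avgPower s k r ≤ t} :=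
    ((p.continuousOn_avgPower s k).mono fun r hr =>
      (p.alt_pos k).trans_le hr).preimage_isClosed_of_isClosed isClosed_Ici isClosed_Iic
  exact hcl.csInf_mem hne ⟨p.alt k, fun _ hr => hr.1⟩

lemma lt_avgPower_of_lt_invPower {r : ℝ} (hr : p.alt k ≤ r) (hrt : r < p.invPower s k t) :
    t < p.avgPower s k r := by
  by_contra h
  have hmem : r ∈ {r | p.alt k ≤ r ∧ p.avgPower s k r ≤ t} := ⟨hr, not_lt.1 h⟩
  exact absurd (csInf_le ⟨p.alt k, fun _ hr => hr.1⟩ hmem) (not_le.2 hrt)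

lemma avgPower_lt_of_invPower_lt (ht : 0 < t) {r : ℝ} (hrt : p.invPower s k t < r) :
    p.avgPower s k r < t :=
  have h := p.invPower_mem s k ht
  (p.avgPower_strictAntiOn s k h.1 (h.1.trans hrt.le) hrt).trans_le h.2

/-- Powers just to the left of the infimum exceed `t`, and continuity gives equality. At `H_k`
itself there is no left side within the range, and equality may fail. -/
lemma avgPower_invPower (ht : 0 < t) (h : p.alt k < p.invPower s k t) :
    p.avgPower s k (p.invPower s k t) = t := by
  refine le_antisymm (p.invPower_mem s k ht).2 ?_
  have hc : ContinuousAt (p.avgPower s k) (p.invPower s k t) :=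
    (p.continuousOn_avgPower s k).continuousAt (Ioi_mem_nhds ((p.alt_pos k).trans h))
  refine ge_of_tendsto
    (hc.tendsto.mono_left (nhdsWithin_le_nhds (s := Set.Iio (p.invPower s k t)))) ?_
  filter_upwards [Ioo_mem_nhdsLT h] with r hr
  exact (p.lt_avgPower_of_lt_invPower s k hr.1.le hr.2).le

lemma invPower_eq_alt (h : p.avgPower s k (p.alt k) ≤ t) : p.invPower s k t = p.alt k :=
  le_antisymm (csInf_le ⟨p.alt k, fun _ hr => hr.1⟩ ⟨le_rfl, h⟩)
    (le_csInf ⟨p.alt k, le_rfl, h⟩ fun _ hr => hr.1)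

end InvPower

/-! ### Regions of the ground plane -/

/-- The length of a link to the typical user from horizontal position `y` and altitude `H`. -/
def linkLength (H : ℝ) (y : Plane) : ℝ := Real.sqrt (‖y‖ ^ 2 + H ^ 2)

@[fun_prop]
lemma measurable_linkLength (H : ℝ) : Measurable (linkLength H) := by
  unfold linkLength
  fun_prop

lemma le_linkLength (H : ℝ) (y : Plane) : H ≤ linkLength H y :=
  Real.le_sqrt_of_sq_le (by nlinarith [sq_nonneg ‖y‖])

lemma linkLength_le_iff {H d : ℝ} (hd : 0 ≤ d) (y : Plane) :
    linkLength H y ≤ d ↔ ‖y‖ ^ 2 ≤ d ^ 2 - H ^ 2 := by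
  rw [linkLength, Real.sqrt_le_left hd]
  constructor <;> intro h <;> linarith

lemma linkLength_le_iff_mem_closedBall {H d : ℝ} (hH : 0 ≤ H) (hd : H ≤ d) (y : Plane) :
    linkLength H y ≤ d ↔ y ∈ Metric.closedBall (0 : Plane) (Real.sqrt (d ^ 2 - H ^ 2)) := by
  rw [linkLength_le_iff (hH.trans hd), mem_closedBall_zero_iff, Real.le_sqrt (norm_nonneg _)]
  nlinarith

lemma volume_linkLength_le {H d : ℝ} (hH : 0 ≤ H) (hd : H ≤ d) :
    volume {y : Plane | linkLength H y ≤ d} = ENNReal.ofReal ((d ^ 2 - H ^ 2) * Real.pi) := by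
  have h0 : 0 ≤ d ^ 2 - H ^ 2 := by nlinarith
  have : {y : Plane | linkLength H y ≤ d} =
      Metric.closedBall (0 : Plane) (Real.sqrt (d ^ 2 - H ^ 2)) :=
    Set.ext fun y => linkLength_le_iff_mem_closedBall hH hd y
  rw [this, EuclideanSpace.volume_closedBall_fin_two, ← ENNReal.ofReal_pow (Real.sqrt_nonneg _),
    Real.sq_sqrt h0, ← NNReal.coe_real_pi, ENNReal.ofReal_mul h0, ENNReal.ofReal_coe_nnreal]

lemma volume_linkLength_eq (H d : ℝ) : volume {y : Plane | linkLength H y = d} = 0 := by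
  rcases Set.eq_empty_or_nonempty {y : Plane | linkLength H y = d} with h | ⟨z, hz⟩
  · simp [h]
  · refine measure_mono_null (fun y hy => ?_) (Measure.addHaar_sphere volume (0 : Plane) ‖z‖)
    have h1 : linkLength H y = linkLength H z := hy.trans hz.symm
    rw [linkLength, linkLength, Real.sqrt_inj (by positivity) (by positivity)] at h1
    rw [mem_sphere_zero_iff_norm]
    have h2 : ‖y‖ ^ 2 = ‖z‖ ^ 2 := by linarith
    exact (sq_eq_sq₀ (norm_nonneg _) (norm_nonneg _)).1 h2

/-- Strict monotonicity confines a level set to a circle. Hence ties at a fixed power have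
probability zero, and strict and weak inequalities become interchangeable. -/
lemma volume_avgPower_eq (t : ℝ) :
    volume {y : Plane | p.avgPower s k (linkLength (p.alt k) y) = t} = 0 := by
  rcases Set.eq_empty_or_nonempty
    {y : Plane | p.avgPower s k (linkLength (p.alt k) y) = t} with h | ⟨z, hz⟩
  · rw [h, measure_empty]
  · refine measure_mono_null (fun y hy => ?_)
      (volume_linkLength_eq (p.alt k) (linkLength (p.alt k) z))
    exact (p.avgPower_strictAntiOn s k).injOn (le_linkLength (p.alt k) y)
      (le_linkLength (p.alt k) z) (Eq.trans hy (Eq.symm hz))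

lemma volume_le_avgPower_ne_top {t : ℝ} (ht : 0 < t) :
    volume {y : Plane | t ≤ p.avgPower s k (linkLength (p.alt k) y)} ≠ ∞ := by
  have h := p.invPower_mem s k ht
  have h1 : {y : Plane | t ≤ p.avgPower s k (linkLength (p.alt k) y)} ⊆
      {y | linkLength (p.alt k) y ≤ p.invPower s k t} := fun y hy => by
    by_contra hlt
    exact absurd hy (not_le.2 (p.avgPower_lt_of_invPower_lt s k ht (not_le.1 hlt)))
  refine ne_top_of_le_ne_top ?_ (measure_mono h1)
  rw [volume_linkLength_le (p.alt_pos k).le h.1]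
  exact ENNReal.ofReal_ne_top

/-- The region where the received power is below `R`, but not by more than a constant factor, has
area bounded below, uniformly in `R`. -/
lemma exists_volume_annulus {Rmax : ℝ} (hmax : 0 < Rmax) : ∃ c, 0 < c ∧ ∀ R, 0 < R → R ≤ Rmax →
    ENNReal.ofReal Real.pi ≤ volume {y : Plane |
      c * R ≤ p.avgPower s k (linkLength (p.alt k) y) ∧
        p.avgPower s k (linkLength (p.alt k) y) < R} := by
  obtain ⟨c, hc, hcr⟩ := p.exists_mul_avgPower_le s k
  have hH := p.alt_pos k
  have hf := p.avgPower_pos s k hH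
  -- The minimum covers levels `R` above the largest power `l_k(H_k)`: the annulus then starts at `d
  -- = H_k`, where the power is only `l_k(H_k) ≥ (l_k(H_k) / Rmax) R`.
  refine ⟨c * min 1 (p.avgPower s k (p.alt k) / Rmax), by positivity, fun R hR hRm => ?_⟩
  obtain ⟨h1, h2⟩ := p.invPower_mem s k hR
  set d := p.invPower s k R with hd
  have h3 : min 1 (p.avgPower s k (p.alt k) / Rmax) * R ≤ p.avgPower s k d := by
    rcases h1.eq_or_lt with h | h
    · rw [← h]
      calc _ ≤ p.avgPower s k (p.alt k) / Rmax * R := by gcongr; exact min_le_right _ _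
        _ ≤ p.avgPower s k (p.alt k) / Rmax * Rmax := by gcongr
        _ = _ := div_mul_cancel₀ _ hmax.ne'
    · rw [hd, p.avgPower_invPower s k hR h]
      exact mul_le_of_le_one_left hR.le (min_le_left _ _)
  have hsub : {y : Plane | linkLength (p.alt k) y ≤ d + 1} \
      {y : Plane | linkLength (p.alt k) y ≤ d} ⊆ {y : Plane |
      c * min 1 (p.avgPower s k (p.alt k) / Rmax) * R ≤ p.avgPower s k (linkLength (p.alt k) y) ∧
        p.avgPower s k (linkLength (p.alt k) y) < R} := by
    rintro y ⟨hy1, hy2⟩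
    refine ⟨?_, p.avgPower_lt_of_invPower_lt s k hR (not_le.1 hy2)⟩
    calc _ ≤ c * p.avgPower s k d := by rw [mul_assoc]; gcongr
      _ ≤ p.avgPower s k (d + 1) := hcr d h1
      _ ≤ _ := (p.avgPower_strictAntiOn s k).antitoneOn (le_linkLength (p.alt k) y)
        (h1.trans (by linarith) : p.alt k ≤ d + 1) hy1
  refine le_trans ?_ (measure_mono hsub)
  refine le_trans ?_ le_measure_sdiff
  rw [volume_linkLength_le hH.le h1, volume_linkLength_le hH.le (h1.trans (by linarith)),
    ← ENNReal.ofReal_sub _ (mul_nonneg (by nlinarith) Real.pi_pos.le)]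
  refine ENNReal.ofReal_le_ofReal ?_
  -- Link lengths in `(d, d + 1]` fill a planar annulus of area `((d + 1)² - d²) π = (2 d + 1) π ≥
  -- π`.
  nlinarith [mul_pos (hH.trans_le h1) Real.pi_pos]

end Params

/-! ### The association probability -/

namespace Params

/-- Polar coordinates, followed by the substitution `x = √(r² + H²)`, for which `x dx = r dr`. -/
lemma lintegral_linkLength_le {H d : ℝ} (hH : 0 < H) (hd : H ≤ d) {w : ℝ → ℝ}
    (hwm : Measurable w) (hwc : ContinuousOn w (Set.Ioi 0)) (hw0 : ∀ x, 0 ≤ w x)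
    (hw1 : ∀ x, w x ≤ 1) :
    ∫⁻ y in {y : Plane | linkLength H y ≤ d}, ENNReal.ofReal (w (linkLength H y)) =
      ENNReal.ofReal (2 * Real.pi * ∫ x in H..d, w x * x) := by
  have h0 : 0 ≤ d ^ 2 - H ^ 2 := by nlinarith
  set ρ := Real.sqrt (d ^ 2 - H ^ 2) with hρ
  have hρ0 : 0 ≤ ρ := Real.sqrt_nonneg _
  have hρ2 : ρ ^ 2 = d ^ 2 - H ^ 2 := Real.sq_sqrt h0
  have hms : MeasurableSet {y : Plane | linkLength H y ≤ d} :=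
    measurableSet_le (measurable_linkLength H) measurable_const
  have hint : IntegrableOn (fun y : Plane => w (linkLength H y))
      {y : Plane | linkLength H y ≤ d} := by
    refine Measure.integrableOn_of_bounded (M := 1) ?_
      (hwm.comp (measurable_linkLength H)).aestronglyMeasurable ?_
    · rw [volume_linkLength_le hH.le hd]
      exact ENNReal.ofReal_ne_top
    · exact Eventually.of_forall fun y => by
        rw [Real.norm_of_nonneg (hw0 _)]
        exact hw1 _
  rw [← ofReal_integral_eq_lintegral_ofReal hint (Eventually.of_forall fun y => hw0 _)]
  congr 1
  rw [← integral_indicator hms]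
  let F : ℝ → ℝ := (Set.Iic ρ).indicator fun r => w (Real.sqrt (r ^ 2 + H ^ 2))
  have hF : ∀ y : Plane, ({y : Plane | linkLength H y ≤ d}.indicator
      fun y => w (linkLength H y)) y = F ‖y‖ := fun y => by
    have hiff : y ∈ {y : Plane | linkLength H y ≤ d} ↔ ‖y‖ ∈ Set.Iic ρ := by
      rw [Set.mem_ofPred, linkLength_le_iff_mem_closedBall hH.le hd, mem_closedBall_zero_iff,
        Set.mem_Iic]
    by_cases hy : y ∈ {y : Plane | linkLength H y ≤ d}
    · rw [Set.indicator_of_mem hy]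
      simp only [F]
      rw [Set.indicator_of_mem (hiff.1 hy)]
      rfl
    · rw [Set.indicator_of_notMem hy]
      simp only [F]
      rw [Set.indicator_of_notMem fun h => hy (hiff.2 h)]
  rw [integral_congr_ae (Eventually.of_forall hF), integral_fun_norm_addHaar volume F]
  have hball : (volume : Measure Plane).real (Metric.ball 0 1) = Real.pi := by
    rw [measureReal_def, EuclideanSpace.volume_ball_fin_two]
    simp [Real.pi_pos.le]
  have hI : ∫ r in Set.Ioi (0 : ℝ), r ^ (Module.finrank ℝ Plane - 1) • F r =
      ∫ r in (0 : ℝ)..ρ, w (Real.sqrt (r ^ 2 + H ^ 2)) * r := by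
    rw [intervalIntegral.integral_of_le hρ0, ← Set.Ioi_inter_Iic,
      ← setIntegral_indicator measurableSet_Iic, finrank_euclideanSpace_fin]
    refine integral_congr_ae (Eventually.of_forall fun r => ?_)
    by_cases hr : r ∈ Set.Iic ρ
    · simp only [F, Set.indicator_of_mem hr, smul_eq_mul]
      ring
    · simp only [F, Set.indicator_of_notMem hr, smul_zero]
  have hsub : ∫ r in (0 : ℝ)..ρ, w (Real.sqrt (r ^ 2 + H ^ 2)) * r = ∫ x in H..d, w x * x := by
    have hpos : ∀ r : ℝ, 0 < r ^ 2 + H ^ 2 := fun r => by positivity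
    have h1 := intervalIntegral.integral_comp_mul_deriv' (a := 0) (b := ρ)
      (f := fun r : ℝ => Real.sqrt (r ^ 2 + H ^ 2))
      (f' := fun r => r / Real.sqrt (r ^ 2 + H ^ 2)) (g := fun x => w x * x) (fun r _ => ?_) ?_ ?_
    · simp only [Function.comp_apply] at h1
      rw [hρ2] at h1
      have e1 : Real.sqrt ((0 : ℝ) ^ 2 + H ^ 2) = H := by
        rw [zero_pow two_ne_zero, zero_add, Real.sqrt_sq hH.le]
      have e2 : Real.sqrt (d ^ 2 - H ^ 2 + H ^ 2) = d := by
        rw [sub_add_cancel, Real.sqrt_sq (hH.le.trans hd)]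
      rw [e1, e2] at h1
      rw [← h1]
      refine intervalIntegral.integral_congr fun r _ => ?_
      have := (Real.sqrt_pos.2 (hpos r)).ne'
      field_simp
    · have h2 : HasDerivAt (fun r : ℝ => r ^ 2 + H ^ 2) (2 * r) r := by
        simpa using (hasDerivAt_pow 2 r).add_const (H ^ 2)
      convert h2.sqrt (hpos r).ne' using 1
      ring
    · refine ContinuousOn.div continuousOn_id (by fun_prop) fun r _ =>
        (Real.sqrt_pos.2 (hpos r)).ne'
    · refine (hwc.mul continuousOn_id).mono ?_
      rintro _ ⟨r, -, rfl⟩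
      exact Real.sqrt_pos.2 (hpos r)
  rw [hI, hsub, hball, finrank_euclideanSpace_fin]
  simp
  ring

variable (p : Params) (s : Antenna)

lemma pL_nonneg (r : ℝ) : 0 ≤ p.pL r := by
  have := p.mua_pos
  unfold pL
  positivity

lemma pL_le_one (r : ℝ) : p.pL r ≤ 1 := by
  have := p.mua_pos
  unfold pL
  rw [div_le_one (by positivity)]
  have : 0 ≤ p.mua * Real.exp (-p.mub * (180 / Real.pi * Real.arcsin (p.Hu / r) - p.mua)) := by
    positivity
  linarith

lemma continuousOn_pL : ContinuousOn p.pL (Set.Ioi 0) := by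
  have h1 : ContinuousOn (fun r => Real.arcsin (p.Hu / r)) (Set.Ioi 0) :=
    Real.continuous_arcsin.comp_continuousOn
      (continuousOn_const.div continuousOn_id fun _ hr => ne_of_gt hr)
  have := p.mua_pos
  unfold pL
  refine continuousOn_const.div (by fun_prop) fun r _ => ?_
  positivity

/-- The probability that a UAV at distance `r` belongs to tier `k`. -/
def tierProb (k : Tier) (r : ℝ) : ℝ :=
  match k with
  | .b => 0
  | .L => p.pL r
  | .N => p.pN r

lemma measurable_tierProb (k : Tier) : Measurable (p.tierProb k) := by
  cases k
  · exact measurable_const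
  · exact p.measurable_pL
  · exact measurable_const.sub p.measurable_pL

lemma tierProb_nonneg (k : Tier) (r : ℝ) : 0 ≤ p.tierProb k r := by
  cases k
  · exact le_rfl
  · exact p.pL_nonneg r
  · exact sub_nonneg.2 (p.pL_le_one r)

lemma tierProb_le_one (k : Tier) (r : ℝ) : p.tierProb k r ≤ 1 := by
  cases k
  · exact zero_le_one
  · exact p.pL_le_one r
  · exact sub_le_self _ (p.pL_nonneg r)

lemma continuousOn_tierProb (k : Tier) : ContinuousOn (p.tierProb k) (Set.Ioi 0) := by
  cases k
  · exact continuousOn_const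
  · exact p.continuousOn_pL
  · exact continuousOn_const.sub p.continuousOn_pL

/-- The probability that the power received from a UAV above `y` lies in `A`. -/
def powerProb (A : Set ℝ) (y : Plane) : ℝ≥0∞ :=
  ((fun y => p.avgPower s .L (linkLength p.Hu y)) ⁻¹' A).indicator
      (fun y => ENNReal.ofReal (p.tierProb .L (linkLength p.Hu y))) y +
    ((fun y => p.avgPower s .N (linkLength p.Hu y)) ⁻¹' A).indicator
      (fun y => ENNReal.ofReal (p.tierProb .N (linkLength p.Hu y))) y

/-- Whether `A` contains its endpoint `t` is immaterial because the critical circle is null. The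
upper and lower bounds on `A_b` use the open and the closed half-line respectively. -/
lemma lintegral_indicator_avgPower {k : Tier} (hk : k ≠ .b) {t : ℝ} (ht : 0 < t) {A : Set ℝ}
    (hA1 : Set.Ioi t ⊆ A) (hA2 : A ⊆ Set.Ici t) :
    ∫⁻ y : Plane, ((fun y => p.avgPower s k (linkLength p.Hu y)) ⁻¹' A).indicator
      (fun y => ENNReal.ofReal (p.tierProb k (linkLength p.Hu y))) y =
    ENNReal.ofReal (2 * Real.pi * ∫ x in p.Hu..p.invPower s k t, p.tierProb k x * x) := by
  have halt : p.alt k = p.Hu := by cases k <;> first | rfl | exact absurd rfl hk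
  have hmem := p.invPower_mem s k ht
  rw [halt] at hmem
  rw [← lintegral_linkLength_le p.Hu_pos hmem.1 (p.measurable_tierProb k)
    (p.continuousOn_tierProb k) (p.tierProb_nonneg k) (p.tierProb_le_one k),
    ← lintegral_indicator (measurableSet_le (measurable_linkLength _) measurable_const)]
  refine lintegral_congr_ae ?_
  have hnull : ∀ᵐ y : Plane, linkLength p.Hu y ≠ p.invPower s k t := by
    rw [ae_iff]
    simpa using volume_linkLength_eq p.Hu (p.invPower s k t)
  filter_upwards [hnull] with y hy
  rcases lt_or_gt_of_ne hy with h | h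
  · rw [Set.indicator_of_mem, Set.indicator_of_mem]
    · exact h.le
    · exact hA1 (p.lt_avgPower_of_lt_invPower s k (halt ▸ le_linkLength _ y) h)
  · rw [Set.indicator_of_notMem, Set.indicator_of_notMem]
    · exact not_le.2 h
    · exact fun hc => absurd (hA2 hc) (not_le.2 (p.avgPower_lt_of_invPower_lt s k ht h))

lemma lintegral_powerProb {t : ℝ} (ht : 0 < t) {A : Set ℝ} (hA : MeasurableSet A)
    (hA1 : Set.Ioi t ⊆ A) (hA2 : A ⊆ Set.Ici t) :
    ∫⁻ y, p.powerProb s A y = ENNReal.ofReal (2 * Real.pi *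
      ((∫ x in p.Hu..p.invPower s .L t, p.pL x * x) +
        ∫ x in p.Hu..p.invPower s .N t, p.pN x * x)) := by
  have hm : ∀ k, p.alt k = p.Hu → 0 ≤ ∫ x in p.Hu..p.invPower s k t, p.tierProb k x * x :=
    fun k hk => intervalIntegral.integral_nonneg (hk ▸ (p.invPower_mem s k ht).1) fun x hx =>
      mul_nonneg (p.tierProb_nonneg k x) (p.Hu_pos.le.trans hx.1)
  unfold powerProb
  rw [lintegral_add_left, p.lintegral_indicator_avgPower s (by simp) ht hA1 hA2,
    p.lintegral_indicator_avgPower s (by simp) ht hA1 hA2, ← ENNReal.ofReal_add, ← mul_add]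
  · rfl
  · have := hm .L rfl
    positivity
  · have := hm .N rfl
    positivity
  · refine Measurable.indicator ?_ ?_
    · have := p.measurable_tierProb .L
      fun_prop
    · exact ((p.measurable_avgPower s .L).comp (measurable_linkLength _)) hA

end Params

/-! ### Line-of-sight marks and void probabilities -/

lemma volume_restrict_Icc_Iic {a : ℝ} (ha : a ≤ 1) :
    (volume.restrict (Set.Icc (0 : ℝ) 1)) (Set.Iic a) = ENNReal.ofReal a := by
  rw [Measure.restrict_apply measurableSet_Iic]
  have : Set.Iic a ∩ Set.Icc 0 1 = Set.Icc 0 a := by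
    ext x
    simp only [Set.mem_inter_iff, Set.mem_Iic, Set.mem_Icc]
    exact ⟨fun h => ⟨h.2.1, h.1⟩, fun h => ⟨h.2, h.1, h.2.trans ha⟩⟩
  rw [this, Real.volume_Icc, sub_zero]

lemma volume_restrict_Icc_Ioi {a : ℝ} (ha0 : 0 ≤ a) :
    (volume.restrict (Set.Icc (0 : ℝ) 1)) (Set.Ioi a) = ENNReal.ofReal (1 - a) := by
  rw [Measure.restrict_apply measurableSet_Ioi]
  have : Set.Ioi a ∩ Set.Icc 0 1 = Set.Ioc a 1 := by
    ext x
    simp only [Set.mem_inter_iff, Set.mem_Ioi, Set.mem_Icc, Set.mem_Ioc]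
    exact ⟨fun h => ⟨h.1, h.2.2⟩, fun h => ⟨h.1, ha0.trans h.1.le, h.2⟩⟩
  rw [this, Real.volume_Ioc]

instance : IsProbabilityMeasure (volume.restrict (Set.Icc (0 : ℝ) 1)) := ⟨by simp⟩

-- Test functions with values in `{0, ∞}` turn a Laplace functional into the probability that no
-- point satisfies `q`.
open Classical in
lemma negExp_tsum_ite {ι α : Type*} (q : ι → α → Prop) (a : α) :
    negExp (∑' i, if q i a then ∞ else 0) =
      Set.indicator {a | ∀ i, ¬ q i a} (1 : α → ℝ≥0∞) a := by
  by_cases h : a ∈ {a | ∀ i, ¬ q i a}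
  · have h' : ∀ i, ¬ q i a := h
    rw [Set.indicator_of_mem h]
    simp [h']
  · have h' : ∃ i, q i a := by
      by_contra hc
      exact h (not_exists.1 hc)
    obtain ⟨i, hi⟩ := h'
    rw [Set.indicator_of_notMem h, ENNReal.tsum_eq_top_of_eq_top ⟨i, if_pos hi⟩, negExp_top]

/-- Almost surely, a Poisson process has finitely many points in a set of finite intensity. -/
lemma IsPoisson.ae_finite {Ω E : Type*} [MeasurableSpace Ω] [MeasurableSpace E] {P : Measure Ω}
    {X : ℕ → Ω → E} {Lam : Measure E} (h : IsPoisson (pointMeasure X) Lam P) {K : Set E}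
    (hKm : MeasurableSet K) (hK : Lam K ≠ ∞) : ∀ᵐ ω ∂P, {i | X i ω ∈ K}.Finite := by
  have hm : Measurable fun ω => pointMeasure X ω K :=
    (Measure.measurable_coe hKm).comp h.measurable
  have h1 : ∀ᵐ t ∂(P.map fun ω => pointMeasure X ω K), t ≠ ∞ := by
    rw [h.count_law K hKm hK]
    refine (ae_map_iff (p := fun t : ℝ≥0∞ => t ≠ ∞) (by fun_prop)
      (measurableSet_singleton (∞ : ℝ≥0∞)).compl).2 ?_
    exact Eventually.of_forall fun n => ENNReal.natCast_ne_top n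
  filter_upwards [ae_of_ae_map hm.aemeasurable h1] with ω hω
  rw [pointMeasure, Measure.sum_apply _ hKm] at hω
  refine (ENNReal.finite_const_le_of_tsum_ne_top hω one_ne_zero).subset fun i hi => ?_
  have hi' : X i ω ∈ K := hi
  rw [Set.mem_ofPred, Measure.dirac_apply' _ hKm, Set.indicator_of_mem hi', Pi.one_apply]

namespace Params

variable (p : Params) (s : Antenna)

open Classical in
/-- The power received from a UAV above `y` with line-of-sight mark `u`. -/
def markedPower (y : Plane) (u : ℝ) : ℝ :=
  if u ≤ p.pL (Params.linkLength p.Hu y) then p.avgPower s .L (Params.linkLength p.Hu y)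
  else p.avgPower s .N (Params.linkLength p.Hu y)

lemma measurable_markedPower : Measurable (Function.uncurry (p.markedPower s)) := by
  have h1 : Measurable fun z : Plane × ℝ => Params.linkLength p.Hu z.1 :=
    (Params.measurable_linkLength _).comp measurable_fst
  exact Measurable.ite (measurableSet_le measurable_snd (p.measurable_pL.comp h1))
    ((p.measurable_avgPower s .L).comp h1) ((p.measurable_avgPower s .N).comp h1)

/-- The uniform mark falls below `p_L` with probability `p_L` and above it with probability `p_N`;
in each case the power is deterministic. -/
lemma measure_markedPower_mem (A : Set ℝ) (y : Plane) :
    (volume.restrict (Set.Icc (0 : ℝ) 1)) {u | p.markedPower s y u ∈ A} = p.powerProb s A y := by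
  set a := p.pL (Params.linkLength p.Hu y) with ha
  have hu : {u | p.markedPower s y u ∈ A} =
      (Set.Iic a ∩ {_u | p.avgPower s .L (Params.linkLength p.Hu y) ∈ A}) ∪
      (Set.Ioi a ∩ {_u | p.avgPower s .N (Params.linkLength p.Hu y) ∈ A}) := by
    ext u
    by_cases h : u ≤ a
    · simp [markedPower, ← ha, h]
    · simp [markedPower, ← ha, h, not_le.1 h]
  rw [hu, measure_union ((Set.Iic_disjoint_Ioi le_rfl).mono Set.inter_subset_left
    Set.inter_subset_left) (measurableSet_Ioi.inter (.const _))]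
  have key : ∀ (k : Tier) (B : Set ℝ), (volume.restrict (Set.Icc (0 : ℝ) 1)) B =
      ENNReal.ofReal (p.tierProb k (Params.linkLength p.Hu y)) →
      (volume.restrict (Set.Icc (0 : ℝ) 1))
        (B ∩ {_u | p.avgPower s k (Params.linkLength p.Hu y) ∈ A}) =
      ((fun y => p.avgPower s k (linkLength p.Hu y)) ⁻¹' A).indicator
        (fun y => ENNReal.ofReal (p.tierProb k (linkLength p.Hu y))) y := by
    intro k B hB
    by_cases h : y ∈ (fun y => p.avgPower s k (linkLength p.Hu y)) ⁻¹' A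
    · rw [Set.indicator_of_mem h, ← hB]
      have h' : p.avgPower s k (Params.linkLength p.Hu y) ∈ A := h
      simp [h']
    · rw [Set.indicator_of_notMem h]
      have h' : p.avgPower s k (Params.linkLength p.Hu y) ∉ A := h
      simp [h']
  exact congrArg₂ (· + ·) (key .L _ (volume_restrict_Icc_Iic (p.pL_le_one _)))
    (key .N _ (volume_restrict_Icc_Ioi (p.pL_nonneg _)))

end Params

namespace Network

variable {Ω : Type*} {D : Network Ω} {p : Params} {s : Antenna}

lemma rxPower_inr (i : ℕ) (ω : Ω) :
    D.rxPower p s (.inr i) ω = p.markedPower s (D.posU i ω) (D.mark .losU (.inr i) ω) := by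
  have hd : D.dist p (.inr i) ω = Params.linkLength p.Hu (D.posU i ω) := rfl
  unfold rxPower
  simp only [tier, Params.markedPower, hd]
  split_ifs <;> rfl

lemma rxPower_inl (j : ℕ) (ω : Ω) :
    D.rxPower p s (.inl j) ω = p.avgPower s .b (Params.linkLength p.Hb (D.posB j ω)) := rfl

lemma tier_eq_b_iff (x : Tx) (ω : Ω) : D.tier p x ω = .b ↔ ∃ j, x = .inl j := by
  rcases x with j | i
  · simp [tier]
  · simp only [tier]
    split_ifs <;> simp

lemma isStrongest_serving {x : Tx} {ω : Ω} (h : D.IsStrongest p s x ω) :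
    D.IsStrongest p s (D.serving p s ω) ω := by
  rcases (serving_eq_iff (D := D) (p := p) (s := s) _ ω).1 rfl with h' | h'
  · exact h'.1
  · exact absurd h (h'.1 x)

variable [MeasurableSpace Ω] {P : Measure Ω} {lamB : ℝ}

/-- The probability that no UAV is received with a power in `A`. -/
lemma IsModel.measure_forall_rxPower_notMem [IsProbabilityMeasure P]
    (h : D.IsModel p s P lamB) {A : Set ℝ} (hA : MeasurableSet A) {t : ℝ} (ht : 0 < t)
    (hAt : A ⊆ Set.Ici t) :
    P {ω | ∀ i, D.rxPower p s (.inr i) ω ∉ A} =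
      negExp (ENNReal.ofReal p.lamU * ∫⁻ y, p.powerProb s A y) := by
  classical
  let f : Plane → ℝ → ℝ≥0∞ := fun y u => if p.markedPower s y u ∈ A then ∞ else 0
  have hf : Measurable (Function.uncurry f) :=
    Measurable.ite (p.measurable_markedPower s hA) measurable_const measurable_const
  let K : Set Plane := {y | t ≤ p.avgPower s .L (Params.linkLength p.Hu y)} ∪
    {y | t ≤ p.avgPower s .N (Params.linkLength p.Hu y)}
  have hK : (ENNReal.ofReal p.lamU • (volume : Measure Plane)) K ≠ ∞ := by
    rw [Measure.smul_apply, smul_eq_mul]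
    refine ENNReal.mul_ne_top ENNReal.ofReal_ne_top ?_
    exact (measure_union_lt_top (p.volume_le_avgPower_ne_top s .L ht).lt_top
      (p.volume_le_avgPower_ne_top s .N ht).lt_top).ne
  have hfK : ∀ y ∉ K, ∀ u, f y u = 0 := fun y hy u => by
    refine if_neg fun hc => hy ?_
    have hc' : t ≤ p.markedPower s y u := hAt hc
    unfold Params.markedPower at hc'
    split_ifs at hc'
    exacts [Or.inl hc', Or.inr hc']
  have hX := fun i => h.measurable_posU i
  have hY := fun i => h.measurable_mark .losU (.inr i)
  have hXY : IndepFun (fun ω i => D.posU i ω) (fun ω i => D.mark .losU (.inr i) ω) P :=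
    h.indepFun (S := {.inl true}) (T := {.inl true}ᶜ) disjoint_compl_right
      (@measurable_pi_lambda _ _ _ (_) _ _ fun i => measurable_posU_infoAlg (by simp) i)
      (@measurable_pi_lambda _ _ _ (_) _ _ fun i => measurable_mark_infoAlg (by simp))
  have key := h.poissonU.lintegral_negExp_marked hX hY hXY
    (h.iIndepFun_mark (q := fun i : ℕ => (MarkKind.losU, (Sum.inr i : Tx)))
      fun i j hij => by simpa using hij) (fun i => h.losU_law _) hf hK hfK
  have hq : ∀ y, 1 - ∫⁻ u, negExp (f y u) ∂(volume.restrict (Set.Icc (0 : ℝ) 1)) =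
      p.powerProb s A y := fun y => by
    have hfy : MeasurableSet {u | p.markedPower s y u ∈ A} :=
      ((p.measurable_markedPower s).comp measurable_prodMk_left) hA
    have h1 : ∀ u, negExp (f y u) = {u | p.markedPower s y u ∈ A}ᶜ.indicator 1 u := fun u => by
      by_cases hu : p.markedPower s y u ∈ A <;> simp [f, hu]
    simp_rw [h1]
    rw [lintegral_indicator_one hfy.compl, prob_compl_eq_one_sub hfy,
      ENNReal.sub_sub_cancel ENNReal.one_ne_top prob_le_one, p.measure_markedPower_mem s A]
  simp_rw [hq] at key
  rw [lintegral_smul_measure, smul_eq_mul] at key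
  rw [← key]
  have hm : MeasurableSet {ω | ∀ i, D.rxPower p s (.inr i) ω ∉ A} := by
    rw [Set.ofPred_forall]
    exact MeasurableSet.iInter fun i => (measurable_rxPower h.measurable_posB h.measurable_posU
      hY (.inr i) hA).compl
  rw [← lintegral_indicator_one hm]
  refine lintegral_congr fun ω => ?_
  simp only [f, ← rxPower_inr]
  exact (negExp_tsum_ite (fun i ω => D.rxPower p s (.inr i) ω ∈ A) ω).symm

/-- Almost surely, only finitely many UAVs are received with a power of at least `t`. -/
lemma IsModel.ae_finite_rxPower (h : D.IsModel p s P lamB) {t : ℝ} (ht : 0 < t) :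
    ∀ᵐ ω ∂P, {i | t ≤ D.rxPower p s (.inr i) ω}.Finite := by
  have hKm : ∀ k, MeasurableSet {y : Plane | t ≤ p.avgPower s k (Params.linkLength p.Hu y)} :=
    fun k => measurableSet_le measurable_const
      ((p.measurable_avgPower s k).comp (Params.measurable_linkLength _))
  have hfin : ∀ k, volume {y : Plane | t ≤ p.avgPower s k (Params.linkLength p.Hu y)} ≠ ∞ →
      ∀ᵐ ω ∂P, {i | D.posU i ω ∈
        {y : Plane | t ≤ p.avgPower s k (Params.linkLength p.Hu y)}}.Finite := fun k hk => by
    refine h.poissonU.ae_finite (hKm k) ?_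
    rw [Measure.smul_apply, smul_eq_mul]
    exact ENNReal.mul_ne_top ENNReal.ofReal_ne_top hk
  filter_upwards [hfin .L (p.volume_le_avgPower_ne_top s .L ht),
    hfin .N (p.volume_le_avgPower_ne_top s .N ht)] with ω hL hN
  refine (hL.union hN).subset fun i hi => ?_
  rw [Set.mem_ofPred, rxPower_inr, Params.markedPower] at hi
  split_ifs at hi
  exacts [Or.inl hi, Or.inr hi]

/-- Upper bound on the probability of association with the TBSs. -/
lemma IsModel.measure_assocEvent_b_le (h : D.IsModel p s P lamB) :
    P (D.assocEvent p s .b) ≤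
      P {ω | ∀ i, D.rxPower p s (.inr i) ω ∉ Set.Ioi (p.avgPower s .b p.Hb)} := by
  refine measure_mono_ae ?_
  -- If some UAV exceeds `l_b(H_b)`, finiteness provides a strongest UAV, which no TBS beats. So a
  -- maximiser exists, the default in `serving` is not used, and a serving TBS would be weaker than
  -- that UAV.
  filter_upwards [h.ae_finite_rxPower (p.avgPower_pos s .b p.Hb_pos)] with ω hfin hω i hi
  obtain ⟨i₁, hi₁, hmax⟩ := hfin.exists_maximalFor (fun i => D.rxPower p s (.inr i) ω) _
    ⟨i, (Set.mem_Ioi.1 hi).le⟩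
  have hmax' : ∀ j, D.rxPower p s (.inr j) ω ≤ D.rxPower p s (.inr i₁) ω := fun j => by
    by_contra hlt
    exact hlt (hmax (le_trans hi₁ (not_le.1 hlt).le) (not_le.1 hlt).le)
  have hb : ∀ j, D.rxPower p s (.inl j) ω ≤ p.avgPower s .b p.Hb := fun j =>
    (p.avgPower_strictAntiOn s .b).antitoneOn (le_refl p.Hb : p.alt .b ≤ p.Hb)
      (Params.le_linkLength p.Hb (D.posB j ω)) (Params.le_linkLength p.Hb (D.posB j ω))
  have hst : D.IsStrongest p s (.inr i₁) ω := by
    rintro (j | j)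
    exacts [(hb j).trans hi₁, hmax' j]
  obtain ⟨j, hj⟩ := (tier_eq_b_iff _ ω).1 hω
  have h1 := isStrongest_serving hst (.inr i)
  rw [hj] at h1
  exact absurd (lt_of_lt_of_le hi h1) (not_lt.2 (hb j))

/-- Lower bound on the probability of association with the TBSs. -/
lemma IsModel.le_measure_assocEvent_b [IsProbabilityMeasure P]
    (h : D.IsModel p s P lamB) {ε : ℝ} (hε : p.Hb ≤ ε) :
    P {ω | ∀ i, D.rxPower p s (.inr i) ω ∉ Set.Ici (p.avgPower s .b ε)} ≤
      P (D.assocEvent p s .b) +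
        negExp (ENNReal.ofReal lamB * ENNReal.ofReal ((ε ^ 2 - p.Hb ^ 2) * Real.pi)) := by
  classical
  let B : Set Plane := {y | Params.linkLength p.Hb y ≤ ε}
  have hB : MeasurableSet B := measurableSet_le (Params.measurable_linkLength _) measurable_const
  have hvol : (ENNReal.ofReal lamB • (volume : Measure Plane)) B =
      ENNReal.ofReal lamB * ENNReal.ofReal ((ε ^ 2 - p.Hb ^ 2) * Real.pi) := by
    rw [Measure.smul_apply, smul_eq_mul, Params.volume_linkLength_le p.Hb_pos.le hε]
  have hfin : (ENNReal.ofReal lamB • (volume : Measure Plane)) B ≠ ∞ := by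
    rw [hvol]
    exact ENNReal.mul_ne_top ENNReal.ofReal_ne_top ENNReal.ofReal_ne_top
  have hempty : P {ω | ∀ j, D.posB j ω ∉ B} =
      negExp (ENNReal.ofReal lamB * ENNReal.ofReal ((ε ^ 2 - p.Hb ^ 2) * Real.pi)) := by
    have hm : Measurable fun y : Plane => if y ∈ B then (∞ : ℝ≥0∞) else 0 :=
      Measurable.ite hB measurable_const measurable_const
    have key := h.poissonB.lintegral_negExp hm hfin fun y hy => if_neg hy
    have hq : ∀ y : Plane, 1 - negExp (if y ∈ B then ∞ else 0) = B.indicator 1 y := fun y => by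
      by_cases hy : y ∈ B <;> simp [hy]
    simp_rw [hq, lintegral_pointMeasure hm] at key
    rw [lintegral_indicator_one hB, hvol] at key
    rw [← key, ← lintegral_indicator_one]
    · exact lintegral_congr fun ω => (negExp_tsum_ite (fun i ω => D.posB i ω ∈ B) ω).symm
    · rw [Set.ofPred_forall]
      exact MeasurableSet.iInter fun i => (h.measurable_posB i hB).compl
  rw [← hempty]
  refine (measure_mono fun ω hω => ?_).trans (measure_union_le _ _)
  by_cases hω' : ∀ j, D.posB j ω ∉ B
  · exact Or.inr hω'
  left
  push Not at hω'
  obtain ⟨j, hj⟩ := hω'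
  have hj' : p.avgPower s .b ε ≤ D.rxPower p s (.inl j) ω :=
    (p.avgPower_strictAntiOn s .b).antitoneOn (Params.le_linkLength p.Hb (D.posB j ω))
      (hε : p.alt .b ≤ ε) hj
  refine (tier_eq_b_iff _ ω).2 ?_
  rcases (serving_eq_iff (D := D) (p := p) (s := s) _ ω).1 rfl with h' | h'
  · rcases hx : D.serving p s ω with j' | i
    · exact ⟨j', rfl⟩
    · rw [hx] at h'
      exact absurd (hj'.trans (h'.1 (.inl j))) (hω i)
  -- Without a maximiser the default server is the TBS `inl 0`, which also belongs to tier `b`.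
  · exact ⟨0, h'.2⟩

end Network

/-! ### Dense limit of the association probability -/

lemma tendsto_negExp_ofReal_mul {c : ℝ≥0∞} (hc : c ≠ 0) :
    Tendsto (fun lam : ℝ => negExp (ENNReal.ofReal lam * c)) atTop (𝓝 0) := by
  have h1 : Tendsto (fun lam : ℝ => ENNReal.ofReal lam * c) atTop (𝓝 ∞) := by
    have := ENNReal.Tendsto.mul_const (b := c) ENNReal.tendsto_ofReal_atTop (Or.inl (by simp))
    rwa [ENNReal.top_mul hc] at this
  simpa [Function.comp_def] using (continuous_negExp.tendsto ∞).comp h1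

namespace Params

variable (p : Params) (s : Antenna)

lemma measurable_powerProb {A : Set ℝ} (hA : MeasurableSet A) : Measurable (p.powerProb s A) := by
  have h : ∀ k, Measurable (((fun y : Plane => p.avgPower s k (linkLength p.Hu y)) ⁻¹' A).indicator
      (fun y => ENNReal.ofReal (p.tierProb k (linkLength p.Hu y)))) := fun k =>
    Measurable.indicator (((p.measurable_tierProb k).comp (measurable_linkLength _)).ennreal_ofReal)
      (((p.measurable_avgPower s k).comp (measurable_linkLength _)) hA)
  exact (h .L).add (h .N)

lemma powerProb_mono {A B : Set ℝ} (hAB : A ⊆ B) (y : Plane) :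
    p.powerProb s A y ≤ p.powerProb s B y := by
  unfold powerProb
  gcongr

/-- Thresholds approach `t` from below, so the indicators of the closed half-lines are eventually
constant at each `y`; the threshold `u 0` supplies the dominating function. -/
lemma tendsto_lintegral_powerProb {t : ℝ} {u : ℕ → ℝ} (hu0 : ∀ n, 0 < u 0 ∧ u 0 ≤ u n)
    (hut : ∀ n, u n ≤ t) (hu : Tendsto u atTop (𝓝 t)) :
    Tendsto (fun n => ∫⁻ y, p.powerProb s (Set.Ici (u n)) y) atTop
      (𝓝 (∫⁻ y, p.powerProb s (Set.Ici t) y)) := by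
  refine tendsto_lintegral_of_dominated_convergence (p.powerProb s (Set.Ici (u 0)))
    (fun n => p.measurable_powerProb s measurableSet_Ici)
    (fun n => Eventually.of_forall
      (p.powerProb_mono s (Set.Ici_subset_Ici.2 (hu0 n).2))) ?_ (Eventually.of_forall fun y => ?_)
  · rw [p.lintegral_powerProb s (hu0 0).1 measurableSet_Ici Set.Ioi_subset_Ici_self subset_rfl]
    exact ENNReal.ofReal_ne_top
  · have h : ∀ k, Tendsto (fun n => ((fun y : Plane => p.avgPower s k (linkLength p.Hu y)) ⁻¹'
        Set.Ici (u n)).indicator (fun y => ENNReal.ofReal (p.tierProb k (linkLength p.Hu y))) y)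
        atTop (𝓝 (((fun y : Plane => p.avgPower s k (linkLength p.Hu y)) ⁻¹'
        Set.Ici t).indicator (fun y => ENNReal.ofReal (p.tierProb k (linkLength p.Hu y))) y)) := by
      intro k
      refine tendsto_const_nhds.congr' ?_
      rcases le_or_gt t (p.avgPower s k (linkLength p.Hu y)) with hy | hy
      · refine Eventually.of_forall fun n => ?_
        dsimp only
        rw [Set.indicator_of_mem, Set.indicator_of_mem]
        exacts [(hut n).trans hy, hy]
      · filter_upwards [hu.eventually (lt_mem_nhds hy)] with n hn
        rw [Set.indicator_of_notMem, Set.indicator_of_notMem]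
        exacts [not_le.2 hn, not_le.2 hy]
    exact (h .L).add (h .N)

/-- The limit of the probability of association with the TBSs. -/
def limitAssocProb : ℝ :=
  Real.exp (-(2 * Real.pi * p.lamU *
    ((∫ x in p.Hu..p.chi s .b .L p.Hb, p.pL x * x) +
      ∫ x in p.Hu..p.chi s .b .N p.Hb, p.pN x * x)))

lemma negExp_lintegral_powerProb {A : Set ℝ} (hA : MeasurableSet A)
    (hA1 : Set.Ioi (p.avgPower s .b p.Hb) ⊆ A) (hA2 : A ⊆ Set.Ici (p.avgPower s .b p.Hb)) :
    negExp (ENNReal.ofReal p.lamU * ∫⁻ y, p.powerProb s A y) =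
      ENNReal.ofReal (p.limitAssocProb s) := by
  have ht := p.avgPower_pos s .b p.Hb_pos
  have hL : 0 ≤ ∫ x in p.Hu..p.chi s .b .L p.Hb, p.pL x * x :=
    intervalIntegral.integral_nonneg (p.invPower_mem s .L ht).1 fun x hx =>
      mul_nonneg (p.tierProb_nonneg .L x) (p.Hu_pos.le.trans hx.1)
  have hN : 0 ≤ ∫ x in p.Hu..p.chi s .b .N p.Hb, p.pN x * x :=
    intervalIntegral.integral_nonneg (p.invPower_mem s .N ht).1 fun x hx =>
      mul_nonneg (p.tierProb_nonneg .N x) (p.Hu_pos.le.trans hx.1)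
  have hl := p.lamU_pos
  rw [p.lintegral_powerProb s ht hA hA1 hA2, ← ENNReal.ofReal_mul hl.le]
  change negExp (ENNReal.ofReal (p.lamU * (2 * Real.pi *
    ((∫ x in p.Hu..p.chi s .b .L p.Hb, p.pL x * x) +
        ∫ x in p.Hu..p.chi s .b .N p.Hb, p.pN x * x)))) = _
  rw [negExp_ofReal (by positivity), limitAssocProb]
  congr 3
  ring

lemma limitAssocProb_pos : 0 < p.limitAssocProb s := Real.exp_pos _

/-- A UAV is strongest directly overhead. There neither link condition beats `l_b(H_b)`, so both `χ`
equal `H_u` and the integrals vanish. -/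
lemma limitAssocProb_eq_one
    (hNL : p.kap .N * p.Hu ^ (-p.al .N) ≤ p.kap .L * p.Hu ^ (-p.al .L))
    (hLb : p.Pu * p.GMu * p.kap .L * p.Hu ^ (-p.al .L) ≤
      p.Pb * p.GMb * p.kap .b * p.Hb ^ (-p.al .b)) : p.limitAssocProb s = 1 := by
  have hL : p.chi s .b .L p.Hb = p.Hu := by
    refine p.invPower_eq_alt s .L ?_
    rw [p.avgPower_b_alt]
    exact (p.avgPower_u_alt s .L (by simp)).trans_le hLb
  have hN : p.chi s .b .N p.Hb = p.Hu := by
    refine p.invPower_eq_alt s .N ?_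
    rw [p.avgPower_b_alt]
    refine (p.avgPower_u_alt s .N (by simp)).trans_le (le_trans ?_ hLb)
    rw [mul_assoc, mul_assoc _ (p.kap .L)]
    exact mul_le_mul_of_nonneg_left hNL (mul_pos p.Pu_pos p.GMu_pos).le
  simp [limitAssocProb, hL, hN]

end Params

namespace Network

/-- The probability of association with the TBSs in the limit of dense TBSs. -/
theorem tendsto_measure_assocEvent_b (p : Params) (s : Antenna) {Ω : ℝ → Type*}
    [∀ lamB, MeasurableSpace (Ω lamB)] (P : ∀ lamB, Measure (Ω lamB))
    [∀ lamB, IsProbabilityMeasure (P lamB)] (D : ∀ lamB, Network (Ω lamB))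
    (hD : ∀ lamB, 0 < lamB → (D lamB).IsModel p s (P lamB) lamB) :
    Tendsto (fun lamB => P lamB ((D lamB).assocEvent p s .b)) atTop
      (𝓝 (ENNReal.ofReal (p.limitAssocProb s))) := by
  have ht := p.avgPower_pos s .b p.Hb_pos
  refine tendsto_order.2 ⟨fun a ha => ?_, fun a ha => ?_⟩
  -- A radius `ε n` close enough to `H_b` is fixed before the density grows; then the probability of
  -- no TBS within `ε n` tends to 0.
  · let ε : ℕ → ℝ := fun n => p.Hb + 1 / ((n : ℝ) + 1)
    have hεH : ∀ n, p.Hb < ε n := fun n => lt_add_of_pos_right _ (by positivity)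
    have hε0 : ∀ n, ε n ≤ ε 0 := fun n => by
      refine add_le_add_right ?_ p.Hb
      rw [div_le_div_iff₀ (by positivity) (by positivity)]
      simp
    have hεt : Tendsto ε atTop (𝓝 p.Hb) := by
      simpa [ε] using (tendsto_one_div_add_atTop_nhds_zero_nat (𝕜 := ℝ)).const_add p.Hb
    have hanti := (p.avgPower_strictAntiOn s .b).antitoneOn
    have hc : ContinuousAt (p.avgPower s .b) p.Hb :=
      (p.continuousOn_avgPower s .b).continuousAt (Ioi_mem_nhds p.Hb_pos)
    have h1 := p.tendsto_lintegral_powerProb s (t := p.avgPower s .b p.Hb)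
      (u := fun n => p.avgPower s .b (ε n))
      (fun n => ⟨p.avgPower_pos s .b (p.Hb_pos.trans (hεH 0)),
        hanti (hεH n).le (hεH 0).le (hε0 n)⟩)
      (fun n => hanti (le_refl p.Hb : p.alt .b ≤ p.Hb) (hεH n).le (hεH n).le)
      (hc.tendsto.comp hεt)
    have h2 : Tendsto (fun n => negExp (ENNReal.ofReal p.lamU *
        ∫⁻ y, p.powerProb s (Set.Ici (p.avgPower s .b (ε n))) y)) atTop
        (𝓝 (ENNReal.ofReal (p.limitAssocProb s))) := by
      rw [← p.negExp_lintegral_powerProb s measurableSet_Ici Set.Ioi_subset_Ici_self subset_rfl]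
      exact (continuous_negExp.tendsto _).comp
        (ENNReal.Tendsto.const_mul h1 (Or.inr ENNReal.ofReal_ne_top))
    obtain ⟨n, hn⟩ := (h2.eventually (lt_mem_nhds ha)).exists
    have hpos : ENNReal.ofReal ((ε n ^ 2 - p.Hb ^ 2) * Real.pi) ≠ 0 := by
      have h3 := hεH n
      have h4 := p.Hb_pos
      have : 0 < (ε n ^ 2 - p.Hb ^ 2) * Real.pi := mul_pos (by nlinarith) Real.pi_pos
      simpa using this
    have h5 := ENNReal.Tendsto.sub (tendsto_const_nhds (x := negExp (ENNReal.ofReal p.lamU *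
        ∫⁻ y, p.powerProb s (Set.Ici (p.avgPower s .b (ε n))) y)))
        (tendsto_negExp_ofReal_mul hpos) (Or.inr (by simp))
    rw [tsub_zero] at h5
    filter_upwards [h5.eventually (lt_mem_nhds hn), eventually_gt_atTop 0] with lamB hlam h0
    refine hlam.trans_le (tsub_le_iff_right.2 ?_)
    have h6 := (hD lamB h0).le_measure_assocEvent_b (hεH n).le
    rwa [(hD lamB h0).measure_forall_rxPower_notMem measurableSet_Ici
      (p.avgPower_pos s .b (p.Hb_pos.trans (hεH n))) subset_rfl] at h6
  · filter_upwards [eventually_gt_atTop 0] with lamB h0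
    refine lt_of_le_of_lt (hD lamB h0).measure_assocEvent_b_le ?_
    rwa [(hD lamB h0).measure_forall_rxPower_notMem measurableSet_Ioi ht
      Set.Ioi_subset_Ici_self, p.negExp_lintegral_powerProb s measurableSet_Ioi subset_rfl
      Set.Ioi_subset_Ici_self]

theorem tendsto_assocProb_b (p : Params) (s : Antenna) {Ω : ℝ → Type*}
    [∀ lamB, MeasurableSpace (Ω lamB)] (P : ∀ lamB, Measure (Ω lamB))
    [∀ lamB, IsProbabilityMeasure (P lamB)] (D : ∀ lamB, Network (Ω lamB))
    (hD : ∀ lamB, 0 < lamB → (D lamB).IsModel p s (P lamB) lamB) :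
    Tendsto (fun lamB => (D lamB).assocProb p s (P lamB) .b) atTop
      (𝓝 (p.limitAssocProb s)) := by
  have h := (ENNReal.tendsto_toReal ENNReal.ofReal_ne_top).comp
    (tendsto_measure_assocEvent_b p s P D hD)
  rwa [ENNReal.toReal_ofReal (p.limitAssocProb_pos s).le] at h

end Network

/-! ### Moments of a conditional probability -/

/-- A conditional probability lies in `[0, 1]`, so its positive powers are at most itself, and its
mean is the probability of the event. This removes the conditioning on the geometry. -/
lemma integral_condExp_indicator_pow_le {Ω : Type*} {m m₀ : MeasurableSpace Ω} {μ : Measure Ω}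
    [IsFiniteMeasure μ] (E : Set Ω) {n : ℕ} (hn : 1 ≤ n) :
    0 ≤ ∫ ω, (condExp m μ (E.indicator fun _ => (1 : ℝ)) ω) ^ n ∂μ ∧
    ∫ ω, (condExp m μ (E.indicator fun _ => (1 : ℝ)) ω) ^ n ∂μ ≤ μ.real E := by
  have hn0 : n ≠ 0 := by omega
  -- If `m` is not a sub-`σ`-algebra or the indicator is not integrable, `condExp` is 0 by
  -- convention and `n ≥ 1` makes the integral 0.
  by_cases hm : m ≤ m₀
  swap
  · simp [condExp_of_not_le hm, hn0]
  by_cases hint : Integrable (E.indicator fun _ => (1 : ℝ)) μ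
  swap
  · simp [condExp_of_not_integrable hint, hn0]
  have h0 : 0 ≤ᵐ[μ] condExp m μ (E.indicator fun _ => (1 : ℝ)) :=
    condExp_nonneg (Eventually.of_forall fun ω => Set.indicator_nonneg (fun _ _ => zero_le_one) ω)
  have h1 : condExp m μ (E.indicator fun _ => (1 : ℝ)) ≤ᵐ[μ] fun _ => 1 := by
    have := condExp_mono (m := m) hint (integrable_const (1 : ℝ)) (Eventually.of_forall fun ω =>
      Set.indicator_le_self' (s := E) (f := fun _ => (1 : ℝ)) (fun _ _ => zero_le_one) ω)
    rwa [condExp_const hm] at this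
  refine ⟨integral_nonneg_of_ae ?_, ?_⟩
  · filter_upwards [h0] with ω hω using pow_nonneg hω n
  · calc ∫ ω, (condExp m μ (E.indicator fun _ => (1 : ℝ)) ω) ^ n ∂μ
        ≤ ∫ ω, condExp m μ (E.indicator fun _ => (1 : ℝ)) ω ∂μ := by
          refine integral_mono_of_nonneg ?_ integrable_condExp ?_
          · filter_upwards [h0] with ω hω using pow_nonneg hω n
          · filter_upwards [h0, h1] with ω hω hω1 using pow_le_of_le_one hω hω1 hn0
      _ = ∫ ω, E.indicator (fun _ => (1 : ℝ)) ω ∂μ := integral_condExp hm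
      _ ≤ μ.real E := by
          -- `E` is the set where the indicator equals 1, so integrability alone already gives null
          -- measurability.
          have hE : NullMeasurableSet E μ := by
            have := hint.aestronglyMeasurable.nullMeasurableSet_eq_fun
              (aestronglyMeasurable_const (b := (1 : ℝ)))
            refine this.congr (Eventually.of_forall fun ω => ?_)
            refine propext ?_
            change E.indicator (fun _ => (1 : ℝ)) ω = 1 ↔ ω ∈ E
            by_cases hω : ω ∈ E <;> simp [hω]
          rw [integral_indicator₀ hE]
          simp

/-! ### Interference of the TBSs -/

/-- The Laplace transform at `1` of the positive part of the law `ν`. -/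
def laplaceOne (ν : Measure ℝ) : ℝ≥0∞ := ∫⁻ u, negExp (ENNReal.ofReal u) ∂ν

/-- Gamma variables are almost surely positive, so the inequality is strict. This makes the rate in
`decay` positive. -/
lemma laplaceOne_gammaMeasure_lt_one {a r : ℝ} (ha : 0 < a) (hr : 0 < r) :
    laplaceOne (gammaMeasure a r) < 1 := by
  have := isProbabilityMeasure_gammaMeasure ha hr
  have h0 : gammaMeasure a r (Set.Iic 0) = 0 := by
    rw [gammaMeasure, withDensity_apply _ measurableSet_Iic, setLIntegral_congr Iio_ae_eq_Iic.symm]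
    exact lintegral_gammaPDF_of_nonpos le_rfl
  have hpos : ∀ᵐ u ∂(gammaMeasure a r), 0 < u := by
    rw [ae_iff]
    simpa [Set.Iic] using h0
  rw [laplaceOne, ← measure_univ (μ := gammaMeasure a r), ← lintegral_one]
  refine lintegral_strict_mono (NeZero.ne _) measurable_one.aemeasurable ?_ ?_
  · exact ((lintegral_mono fun u => negExp_le_one _).trans_lt (by simp)).ne
  · filter_upwards [hpos] with u hu
    rw [negExp_ofReal hu.le, ← ENNReal.ofReal_one,
      ENNReal.ofReal_lt_ofReal_iff one_pos]
    simpa using hu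

namespace Network

variable {Ω : Type*} {D : Network Ω} {p : Params} {s : Antenna}

/-- The fading gain of the link from a TBS. -/
def fadeB (D : Network Ω) (j : ℕ) (ω : Ω) : ℝ := D.mark (.fade .b) (.inl j) ω

lemma interfPower_inl (j : ℕ) (ω : Ω) :
    D.interfPower p s (.inl j) ω =
      p.avgPower s .b (Params.linkLength p.Hb (D.posB j ω)) * D.fadeB j ω := by
  change p.Pb * p.gainB _ * D.fadeB j ω * p.pathLoss .b _ = p.Pb * p.gainB _ * p.pathLoss .b _ * _
  have : D.dist p (.inl j) ω = Params.linkLength p.Hb (D.posB j ω) := rfl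
  rw [this]
  ring

-- Noise and UAV interference are discarded, leaving the TBSs alone to bound the SINR; in
-- particular, where the UAVs point their antennas is irrelevant.
open Classical in
lemma mul_tsum_le_of_lt_SINR {gam : ℝ} {ω : Ω} (h : ENNReal.ofReal gam < D.SINR p s ω) :
    ENNReal.ofReal gam * ∑' j, (if Sum.inl j ≠ D.serving p s ω then ENNReal.ofReal
      (p.avgPower s .b (Params.linkLength p.Hb (D.posB j ω)) * D.fadeB j ω) else 0) ≤
    ENNReal.ofReal (D.rxPower p s (D.serving p s ω) ω * D.fading p (D.serving p s ω) ω) := by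
  have h1 := ENNReal.mul_le_of_le_div h.le
  refine le_trans (mul_le_mul_right ?_ _) h1
  have h2 : D.interference p s .b ω ≤
      ENNReal.ofReal p.N0 + ∑ k : Tier, D.interference p s k ω :=
    (Finset.single_le_sum (f := fun k => D.interference p s k ω) (fun _ _ => zero_le)
      (Finset.mem_univ Tier.b)).trans le_add_self
  refine le_trans ?_ h2
  unfold interference
  refine le_trans (ENNReal.tsum_le_tsum fun j => ?_)
    (ENNReal.tsum_comp_le_tsum_of_injective Sum.inl_injective _)
  rw [← interfPower_inl]
  simp [tier]

end Network

/-! ### Chernoff bounds for the fading gain of the TBSs -/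

namespace Network

variable {Ω : Type*} {D : Network Ω} {p : Params} {s : Antenna}

/-- The sources of randomness that determine the TBSs and their fading. -/
def tbsSources : Set Source :=
  {i | i = .inl false ∨ ∃ j : ℕ, i = .inr (.fade .b, .inl j)}

lemma measurable_tbs_infoAlg {S : Set Source} (hS : tbsSources ⊆ S) :
    Measurable[D.infoAlg S] fun ω => ((fun j => D.posB j ω, fun j => D.fadeB j ω) :
      (ℕ → Plane) × (ℕ → ℝ)) := by
  let _ := D.infoAlg S
  exact (measurable_pi_lambda _ fun j => measurable_posB_infoAlg (hS (Or.inl rfl)) j).prodMk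
    (measurable_pi_lambda _ fun j => measurable_mark_infoAlg (hS (Or.inr ⟨j, rfl⟩)))

variable [MeasurableSpace Ω] {P : Measure Ω} {lamB : ℝ}

lemma IsModel.fadeB_law (h : D.IsModel p s P lamB) (j : ℕ) :
    P.map (D.fadeB j) = gammaMeasure 1 1 := by
  have := h.fade_law .b (.inl j)
  rwa [p.M_b] at this

/-- The Laplace functional of the TBSs marked with their fading gains. -/
lemma IsModel.lintegral_negExp_tbs [IsProbabilityMeasure P] (h : D.IsModel p s P lamB)
    {f : Plane → ℝ → ℝ≥0∞} (hf : Measurable (Function.uncurry f)) {K : Set Plane}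
    (hK : volume K ≠ ∞) (hfK : ∀ x ∉ K, ∀ y, f x y = 0) :
    ∫⁻ ω, negExp (∑' j, f (D.posB j ω) (D.fadeB j ω)) ∂P =
      negExp (ENNReal.ofReal lamB *
        ∫⁻ x, (1 - ∫⁻ y, negExp (f x y) ∂(gammaMeasure 1 1))) := by
  have := isProbabilityMeasure_gammaMeasure one_pos one_pos
  have hXY : IndepFun (fun ω i => D.posB i ω) (fun ω i => D.fadeB i ω) P :=
    h.indepFun (S := {.inl false}) (T := {.inl false}ᶜ) disjoint_compl_right
      (@measurable_pi_lambda _ _ _ (_) _ _ fun i => measurable_posB_infoAlg (by simp) i)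
      (@measurable_pi_lambda _ _ _ (_) _ _ fun i => measurable_mark_infoAlg (by simp))
  have key := h.poissonB.lintegral_negExp_marked h.measurable_posB
    (fun j => h.measurable_mark (.fade .b) (.inl j)) hXY
    (h.iIndepFun_mark (q := fun i : ℕ => (MarkKind.fade .b, (Sum.inl i : Tx)))
      fun i j hij => by simpa using hij) h.fadeB_law hf (K := K) ?_ hfK
  · rw [lintegral_smul_measure, smul_eq_mul] at key
    exact key
  · rw [Measure.smul_apply, smul_eq_mul]
    exact ENNReal.mul_ne_top ENNReal.ofReal_ne_top hK

/-- The Laplace functional of the TBSs for a test function that depends on an independent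
random variable. -/
lemma IsModel.lintegral_indicator_negExp_tbs [IsProbabilityMeasure P]
    (h : D.IsModel p s P lamB) {w : Ω → ℝ} (hw : Measurable w)
    (hind : IndepFun w (fun ω => ((fun j => D.posB j ω, fun j => D.fadeB j ω) :
      (ℕ → Plane) × (ℕ → ℝ))) P)
    {f : ℝ → Plane → ℝ → ℝ≥0∞} (hf : Measurable fun z : ℝ × Plane × ℝ => f z.1 z.2.1 z.2.2)
    {K : ℝ → Set Plane} (hK : ∀ r, 0 < r → volume (K r) ≠ ∞)
    (hfK : ∀ r, ∀ x ∉ K r, ∀ y, f r x y = 0) :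
    ∫⁻ ω, (Set.Ioi (0 : ℝ)).indicator 1 (w ω) *
        negExp (∑' j, f (w ω) (D.posB j ω) (D.fadeB j ω)) ∂P =
      ∫⁻ ω, (Set.Ioi (0 : ℝ)).indicator 1 (w ω) * negExp (ENNReal.ofReal lamB *
        ∫⁻ x, (1 - ∫⁻ y, negExp (f (w ω) x y) ∂(gammaMeasure 1 1))) ∂P := by
  have hY := (measurable_tbs_infoAlg (D := D) subset_rfl).mono (h.infoAlg_le tbsSources) le_rfl
  let F : ℝ → (ℕ → Plane) × (ℕ → ℝ) → ℝ≥0∞ := fun r z =>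
    (Set.Ioi (0 : ℝ)).indicator 1 r * negExp (∑' j, f r (z.1 j) (z.2 j))
  have hF : Measurable (Function.uncurry F) := by
    have h1 : Measurable ((Set.Ioi (0 : ℝ)).indicator (1 : ℝ → ℝ≥0∞)) :=
      measurable_one.indicator measurableSet_Ioi
    refine (h1.comp measurable_fst).mul (measurable_negExp.comp (Measurable.tsum fun j => ?_))
    have h2 : Measurable fun z : ℝ × (ℕ → Plane) × (ℕ → ℝ) => (z.1, z.2.1 j, z.2.2 j) := by
      fun_prop
    exact hf.comp h2
  refine (lintegral_indepFun hw hY hind hF).trans (lintegral_congr fun ω => ?_)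
  -- The support `K r` has finite area only for `r > 0`; elsewhere the indicator makes both sides
  -- zero.
  rcases le_or_gt (w ω) 0 with hω | hω
  · have hω' : w ω ∉ Set.Ioi (0 : ℝ) := not_lt.2 hω
    simp [F, Set.indicator_of_notMem hω']
  · have hω' : w ω ∈ Set.Ioi (0 : ℝ) := hω
    have hfω : Measurable (Function.uncurry (f (w ω))) := hf.comp measurable_prodMk_left
    simp only [F, Set.indicator_of_mem hω', Pi.one_apply, one_mul]
    exact h.lintegral_negExp_tbs hfω (hK _ hω) (hfK _)

open Classical in
/-- The total fading gain of the TBSs in a region. -/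
def fadeSum (D : Network Ω) (A : Set Plane) (ω : Ω) : ℝ≥0∞ :=
  ∑' j, if D.posB j ω ∈ A then ENNReal.ofReal (D.fadeB j ω) else 0

/-- The exponential decay in the TBS density of the probability of a small total fading gain. -/
def decay (lamB : ℝ) : ℝ≥0∞ :=
  negExp (ENNReal.ofReal lamB * ((1 - laplaceOne (gammaMeasure 1 1)) * ENNReal.ofReal Real.pi))

/-- The pointwise inequality behind the Chernoff bounds; Markov's inequality is applied to the
right-hand side. -/
lemma one_le_exp_mul_negExp {c : ℝ} (hc : 0 ≤ c) {t : ℝ≥0∞} (ht : t ≤ ENNReal.ofReal c) :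
    1 ≤ ENNReal.ofReal (Real.exp c) * negExp t := by
  calc (1 : ℝ≥0∞) = ENNReal.ofReal (Real.exp c) * negExp (ENNReal.ofReal c) := by
        rw [negExp_ofReal hc, ← ENNReal.ofReal_mul (Real.exp_pos _).le, ← Real.exp_add]
        simp
    _ ≤ _ := mul_le_mul_right (negExp_antitone ht) _

/-- The probability that the TBSs in a fixed region have a small total fading gain. -/
lemma IsModel.measure_fadeSum_le [IsProbabilityMeasure P] (h : D.IsModel p s P lamB)
    {A : Set Plane} (hA : MeasurableSet A) (hAfin : volume A ≠ ∞)
    (hApi : ENNReal.ofReal Real.pi ≤ volume A) {c : ℝ} (hc : 0 ≤ c) :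
    P {ω | D.fadeSum A ω ≤ ENNReal.ofReal c} ≤ ENNReal.ofReal (Real.exp c) * decay lamB := by
  classical
  have := isProbabilityMeasure_gammaMeasure one_pos one_pos
  let f : Plane → ℝ → ℝ≥0∞ := fun y u => if y ∈ A then ENNReal.ofReal u else 0
  have hf : Measurable (Function.uncurry f) :=
    Measurable.ite (measurable_fst hA) measurable_snd.ennreal_ofReal measurable_const
  have hm : Measurable fun ω => negExp (D.fadeSum A ω) := by
    refine measurable_negExp.comp (Measurable.tsum fun j => ?_)
    exact hf.comp ((h.measurable_posB j).prodMk (h.measurable_mark (.fade .b) (.inl j)))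
  calc P {ω | D.fadeSum A ω ≤ ENNReal.ofReal c}
      ≤ P {ω | 1 ≤ ENNReal.ofReal (Real.exp c) * negExp (D.fadeSum A ω)} :=
        measure_mono fun ω hω => one_le_exp_mul_negExp hc hω
    _ ≤ ∫⁻ ω, ENNReal.ofReal (Real.exp c) * negExp (D.fadeSum A ω) ∂P := by
        simpa using mul_meas_ge_le_lintegral (μ := P) (hm.const_mul _) 1
    _ = ENNReal.ofReal (Real.exp c) * ∫⁻ ω, negExp (D.fadeSum A ω) ∂P :=
        lintegral_const_mul _ hm
    _ ≤ ENNReal.ofReal (Real.exp c) * decay lamB := by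
        refine mul_le_mul_right ?_ _
        refine (h.lintegral_negExp_tbs hf hAfin fun y hy u => if_neg hy).trans_le ?_
        refine negExp_antitone (mul_le_mul_right ?_ _)
        have h1 : ∀ y, (1 - ∫⁻ u, negExp (f y u) ∂(gammaMeasure 1 1)) =
            A.indicator (fun _ => 1 - laplaceOne (gammaMeasure 1 1)) y := fun y => by
          by_cases hy : y ∈ A <;> simp [f, hy, laplaceOne]
        simp_rw [h1]
        rw [lintegral_indicator_const hA]
        gcongr

/-- The region in which a TBS is received with a power in `[c r, r)`. -/
def annulus (p : Params) (s : Antenna) (c r : ℝ) : Set Plane :=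
  {y | c * r ≤ p.avgPower s .b (Params.linkLength p.Hb y) ∧
    p.avgPower s .b (Params.linkLength p.Hb y) < r}

/-- Given that all TBSs are weaker than an independent power `w`, the TBSs that are not much weaker
have a large total fading gain. -/
lemma IsModel.measure_fadeSum_annulus_le [IsProbabilityMeasure P] (h : D.IsModel p s P lamB)
    {w : Ω → ℝ} (hw : Measurable w)
    (hind : IndepFun w (fun ω => ((fun j => D.posB j ω, fun j => D.fadeB j ω) :
      (ℕ → Plane) × (ℕ → ℝ))) P)
    {c a : ℝ} (hc : 0 < c) (ha : 0 ≤ a)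
    (hwc : ∀ ω, 0 < w ω → ENNReal.ofReal Real.pi ≤ volume (annulus p s c (w ω))) :
    P {ω | 0 < w ω ∧ (∀ j, D.rxPower p s (.inl j) ω ≤ w ω) ∧
        D.fadeSum (annulus p s c (w ω)) ω ≤ ENNReal.ofReal a} ≤
      ENNReal.ofReal (Real.exp a) * decay lamB *
        P {ω | 0 < w ω ∧ ∀ j, D.rxPower p s (.inl j) ω < w ω} := by
  classical
  have := isProbabilityMeasure_gammaMeasure one_pos one_pos
  let q : Plane → ℝ := fun y => p.avgPower s .b (Params.linkLength p.Hb y)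
  have hq : Measurable q := (p.measurable_avgPower s .b).comp (Params.measurable_linkLength _)
  -- `f` forbids TBSs stronger than `r` and weighs those in the annulus by their fading; `g` only
  -- forbids TBSs of power at least `r`. Their Laplace functionals will differ by a factor of at
  -- most `decay lamB`.
  let f : ℝ → Plane → ℝ → ℝ≥0∞ := fun r y u =>
    if r < q y then ∞ else if y ∈ annulus p s c r then ENNReal.ofReal u else 0
  let g : ℝ → Plane → ℝ → ℝ≥0∞ := fun r y _ => if r ≤ q y then ∞ else 0
  have hq' : Measurable fun z : ℝ × Plane × ℝ => q z.2.1 := by fun_prop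
  have hr' : Measurable fun z : ℝ × Plane × ℝ => z.1 := by fun_prop
  have hu' : Measurable fun z : ℝ × Plane × ℝ => z.2.2 := by fun_prop
  have hf : Measurable fun z : ℝ × Plane × ℝ => f z.1 z.2.1 z.2.2 :=
    Measurable.ite (measurableSet_lt hr' hq') measurable_const (Measurable.ite
      ((measurableSet_le (hr'.const_mul c) hq').inter (measurableSet_lt hq' hr'))
      hu'.ennreal_ofReal measurable_const)
  have hg : Measurable fun z : ℝ × Plane × ℝ => g z.1 z.2.1 z.2.2 :=
    Measurable.ite (measurableSet_le hr' hq') measurable_const measurable_const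
  have hvol : ∀ t, 0 < t → volume {y | t ≤ q y} ≠ ∞ := fun t ht =>
    p.volume_le_avgPower_ne_top s .b ht
  have hfI := h.lintegral_indicator_negExp_tbs hw hind hf
    (K := fun r => {y | r ≤ q y} ∪ {y | c * r ≤ q y})
    (fun r hr => (measure_union_lt_top (hvol r hr).lt_top
      (hvol _ (mul_pos hc hr)).lt_top).ne) fun r y hy u => by
        have h1 : ¬ r < q y := fun hc' => hy (Or.inl hc'.le)
        have h2 : y ∉ annulus p s c r := fun hc' => hy (Or.inr hc'.1)
        simp only [f, if_neg h1, if_neg h2]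
  have hgI := h.lintegral_indicator_negExp_tbs hw hind hg (K := fun r => {y | r ≤ q y}) hvol
    fun r y hy u => if_neg hy
  have hpt : ∀ ω, 0 < w ω →
      negExp (ENNReal.ofReal lamB *
        ∫⁻ x, (1 - ∫⁻ y, negExp (f (w ω) x y) ∂(gammaMeasure 1 1))) ≤
      decay lamB * negExp (ENNReal.ofReal lamB *
        ∫⁻ x, (1 - ∫⁻ y, negExp (g (w ω) x y) ∂(gammaMeasure 1 1))) := fun ω hω => by
    have hmA : MeasurableSet (annulus p s c (w ω)) :=
      (measurableSet_le measurable_const hq).inter (measurableSet_lt hq measurable_const)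
    have hmB : MeasurableSet {y | w ω ≤ q y} := measurableSet_le measurable_const hq
    have hgx : ∀ x, (1 - ∫⁻ y, negExp (g (w ω) x y) ∂(gammaMeasure 1 1)) =
        {y | w ω ≤ q y}.indicator 1 x := fun x => by
      by_cases hx : w ω ≤ q x <;> simp [g, hx]
    -- The forbidden region and the annulus are disjoint, so the exponent is a sum. `f` and `g`
    -- differ on the level set `q x = w`, which is null; this is what turns `≤` into `<` in the
    -- association events.
    have hfx : ∀ᵐ x, (1 - ∫⁻ y, negExp (f (w ω) x y) ∂(gammaMeasure 1 1)) =
        {y | w ω ≤ q y}.indicator 1 x + (annulus p s c (w ω)).indicator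
          (fun _ => 1 - laplaceOne (gammaMeasure 1 1)) x := by
      have hne : ∀ᵐ x, q x ≠ w ω := by
        rw [ae_iff]
        simp only [ne_eq, not_not]
        exact p.volume_avgPower_eq s .b (w ω)
      filter_upwards [hne] with x hx
      rcases lt_or_gt_of_ne hx with hlt | hlt
      · have h1 : x ∉ {y | w ω ≤ q y} := not_le.2 hlt
        by_cases h2 : x ∈ annulus p s c (w ω) <;>
          simp [f, not_lt.2 hlt.le, h1, h2, laplaceOne]
      · have h1 : x ∈ {y | w ω ≤ q y} := hlt.le
        have h2 : x ∉ annulus p s c (w ω) := fun hc' => lt_asymm hc'.2 hlt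
        rw [Set.indicator_of_mem h1, Set.indicator_of_notMem h2]
        simp [f, hlt]
    simp_rw [hgx]
    rw [lintegral_congr_ae hfx, lintegral_add_left (measurable_one.indicator hmB),
      lintegral_indicator_const hmA, mul_add, negExp_add, mul_comm (decay lamB)]
    refine mul_le_mul_right (negExp_antitone (mul_le_mul_right ?_ _)) _
    exact mul_le_mul_right (hwc ω hω) _
  have hSm : Measurable fun ω => (Set.Ioi (0 : ℝ)).indicator (1 : ℝ → ℝ≥0∞) (w ω) *
      negExp (∑' j, f (w ω) (D.posB j ω) (D.fadeB j ω)) := by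
    have h1 : Measurable ((Set.Ioi (0 : ℝ)).indicator (1 : ℝ → ℝ≥0∞)) :=
      measurable_one.indicator measurableSet_Ioi
    refine (h1.comp hw).mul (measurable_negExp.comp (Measurable.tsum fun j => ?_))
    exact hf.comp (hw.prodMk ((h.measurable_posB j).prodMk
      (h.measurable_mark (.fade .b) (.inl j))))
  have hgS : ∫⁻ ω, (Set.Ioi (0 : ℝ)).indicator 1 (w ω) *
      negExp (∑' j, g (w ω) (D.posB j ω) (D.fadeB j ω)) ∂P ≤
      P {ω | 0 < w ω ∧ ∀ j, D.rxPower p s (.inl j) ω < w ω} := by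
    have hE : MeasurableSet {ω | 0 < w ω ∧ ∀ j, D.rxPower p s (.inl j) ω < w ω} := by
      have : {ω | 0 < w ω ∧ ∀ j, D.rxPower p s (.inl j) ω < w ω} =
          {ω | 0 < w ω} ∩ ⋂ j, {ω | q (D.posB j ω) < w ω} := by
        ext ω
        simp [rxPower_inl, q]
      rw [this]
      exact (measurableSet_lt measurable_const hw).inter (MeasurableSet.iInter fun j =>
        measurableSet_lt (hq.comp (h.measurable_posB j)) hw)
    rw [← lintegral_indicator_one hE]
    refine lintegral_mono fun ω => ?_
    by_cases hω : ω ∈ {ω | 0 < w ω ∧ ∀ j, D.rxPower p s (.inl j) ω < w ω}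
    · rw [Set.indicator_of_mem hω, Pi.one_apply]
      exact mul_le_one' (Set.indicator_le_self' (fun _ _ => zero_le) _) (negExp_le_one _)
    · rw [Set.indicator_of_notMem hω]
      rcases le_or_gt (w ω) 0 with h0 | h0
      · have h0' : w ω ∉ Set.Ioi (0 : ℝ) := not_lt.2 h0
        simp [Set.indicator_of_notMem h0']
      · have : ∃ j, w ω ≤ q (D.posB j ω) := by
          by_contra hc'
          push Not at hc'
          exact hω ⟨h0, hc'⟩
        obtain ⟨j, hj⟩ := this
        rw [ENNReal.tsum_eq_top_of_eq_top ⟨j, if_pos hj⟩, negExp_top, mul_zero]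
  calc _ ≤ P {ω | 1 ≤ ENNReal.ofReal (Real.exp a) * ((Set.Ioi (0 : ℝ)).indicator 1 (w ω) *
        negExp (∑' j, f (w ω) (D.posB j ω) (D.fadeB j ω)))} := by
        refine measure_mono fun ω hω => ?_
        obtain ⟨h1, h2, h3⟩ := hω
        have h1' : w ω ∈ Set.Ioi (0 : ℝ) := h1
        rw [Set.mem_ofPred, Set.indicator_of_mem h1', Pi.one_apply, one_mul]
        refine one_le_exp_mul_negExp ha (le_trans (le_of_eq ?_) h3)
        refine tsum_congr fun j => ?_
        exact if_neg (not_lt.2 (h2 j))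
    _ ≤ ∫⁻ ω, ENNReal.ofReal (Real.exp a) * ((Set.Ioi (0 : ℝ)).indicator 1 (w ω) *
        negExp (∑' j, f (w ω) (D.posB j ω) (D.fadeB j ω))) ∂P := by
        simpa using mul_meas_ge_le_lintegral (μ := P) (hSm.const_mul _) 1
    _ = ENNReal.ofReal (Real.exp a) * ∫⁻ ω, (Set.Ioi (0 : ℝ)).indicator 1 (w ω) *
        negExp (∑' j, f (w ω) (D.posB j ω) (D.fadeB j ω)) ∂P := lintegral_const_mul _ hSm
    _ ≤ ENNReal.ofReal (Real.exp a) * (decay lamB * ∫⁻ ω, (Set.Ioi (0 : ℝ)).indicator 1 (w ω) *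
        negExp (∑' j, g (w ω) (D.posB j ω) (D.fadeB j ω)) ∂P) := by
        rw [hfI, hgI]
        refine mul_le_mul_right ?_ _
        rw [← lintegral_const_mul' (decay lamB) _ (negExp_ne_top _)]
        refine lintegral_mono fun ω => ?_
        rcases le_or_gt (w ω) 0 with hω | hω
        · have hω' : w ω ∉ Set.Ioi (0 : ℝ) := not_lt.2 hω
          simp [Set.indicator_of_notMem hω']
        · have hω' : w ω ∈ Set.Ioi (0 : ℝ) := hω
          simpa only [Set.indicator_of_mem hω', Pi.one_apply, one_mul] using hpt ω hω
    _ ≤ _ := by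
        rw [mul_assoc]
        gcongr

end Network

/-! ### Coverage bounds for each type of serving transmitter -/

namespace Network

variable {Ω : Type*} {D : Network Ω} {p : Params} {s : Antenna}

/-- The event that the `i`-th UAV is the first strongest UAV and belongs to tier `k`. -/
def bestUAV (D : Network Ω) (p : Params) (s : Antenna) (k : Tier) (i : ℕ) : Set Ω :=
  {ω | D.tier p (.inr i) ω = k} ∩
    {ω | ∀ j, D.rxPower p s (.inr j) ω ≤ D.rxPower p s (.inr i) ω ∧
      (j < i → D.rxPower p s (.inr j) ω < D.rxPower p s (.inr i) ω)}

lemma rxPower_inr_pos (i : ℕ) (ω : Ω) : 0 < D.rxPower p s (.inr i) ω :=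
  p.avgPower_pos s _ (p.Hu_pos.trans_le (Params.le_linkLength p.Hu (D.posU i ω)))

lemma servedBy_inr_subset (k : Tier) (i : ℕ) :
    D.servedBy p s k (.inr i) ⊆ D.bestUAV p s k i ∩
      {ω | ∀ j, D.rxPower p s (.inl j) ω ≤ D.rxPower p s (.inr i) ω} := by
  rintro ω ⟨hω, ht⟩
  rcases (serving_eq_iff _ ω).1 hω with ⟨h1, h2⟩ | h
  · refine ⟨⟨ht, fun j => ⟨h1 _, fun hj => ?_⟩⟩, fun j => h1 _⟩
    by_contra hlt
    refine h2 (.inr j) ?_ fun y => (h1 y).trans (not_lt.1 hlt)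
    -- UAV `j` has code `2 j + 1`, so among UAVs the order of codes is that of indices.
    simp only [Encodable.encode_inr, Encodable.encode_nat]
    omega
  · exact absurd h.2 (by simp)

lemma subset_servedBy_inr (k : Tier) (i : ℕ) :
    D.bestUAV p s k i ∩ {ω | ∀ j, D.rxPower p s (.inl j) ω < D.rxPower p s (.inr i) ω} ⊆
      D.servedBy p s k (.inr i) := by
  rintro ω ⟨⟨ht, hU⟩, hB⟩
  refine ⟨(serving_eq_iff _ ω).2 (Or.inl ⟨?_, ?_⟩), ht⟩
  · rintro (j | j)
    exacts [(hB j).le, (hU j).1]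
  · rintro (j | j) hj hst
    · exact absurd (hst (.inr i)) (not_le.2 (hB j))
    · simp only [Encodable.encode_inr, Encodable.encode_nat] at hj
      exact absurd (hst (.inr i)) (not_le.2 ((hU j).2 (by omega)))

lemma measurable_rxPower_inr [MeasurableSpace Ω] {i : ℕ} (hU : Measurable (D.posU i))
    (hl : Measurable (D.mark .losU (.inr i))) : Measurable (D.rxPower p s (.inr i)) := by
  have : D.rxPower p s (.inr i) =
      fun ω => p.markedPower s (D.posU i ω) (D.mark .losU (.inr i) ω) :=
    funext fun ω => rxPower_inr i ω
  rw [this]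
  exact (p.measurable_markedPower s).comp (hU.prodMk hl)

lemma measurableSet_bestUAV [MeasurableSpace Ω] (hU : ∀ i, Measurable (D.posU i))
    (hl : ∀ i, Measurable (D.mark .losU (.inr i))) (k : Tier) (i : ℕ) :
    MeasurableSet (D.bestUAV p s k i) := by
  have hr := fun j => measurable_rxPower_inr (p := p) (s := s) (hU j) (hl j)
  refine (measurableSet_tier_inr (hU i) (hl i) k).inter ?_
  rw [Set.ofPred_forall]
  refine MeasurableSet.iInter fun j => (measurableSet_le (hr j) (hr i)).inter ?_
  have : {ω | j < i → D.rxPower p s (.inr j) ω < D.rxPower p s (.inr i) ω} =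
      {_ω | ¬ j < i} ∪ {ω | D.rxPower p s (.inr j) ω < D.rxPower p s (.inr i) ω} := by
    ext ω
    exact imp_iff_not_or
  change MeasurableSet {ω | j < i → D.rxPower p s (.inr j) ω < D.rxPower p s (.inr i) ω}
  rw [this]
  exact (MeasurableSet.const _).union (measurableSet_lt (hr j) (hr i))

/-- The sources of randomness that determine the positions and tiers of the UAVs. -/
def uavSources : Set Source :=
  {i | i = .inl true ∨ ∃ j : ℕ, i = .inr (.losU, .inr j)}

/-- The sources of randomness that determine the positions and tiers of all transmitters. -/
def geometrySources : Set Source :=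
  {i | (∃ c, i = .inl c) ∨ ∃ j : ℕ, i = .inr (.losU, .inr j)}

/-- The ratio of the powers received from a TBS at the nearest possible distance and one unit
further away. -/
def nearRatio (p : Params) (s : Antenna) : ℝ :=
  p.avgPower s .b p.Hb / p.avgPower s .b (p.Hb + 1)

lemma nearRatio_pos (p : Params) (s : Antenna) : 0 < nearRatio p s :=
  div_pos (p.avgPower_pos s .b p.Hb_pos) (p.avgPower_pos s .b (by linarith [p.Hb_pos]))

/-- The server itself may lie in the region and contributes at most `T`. The others interfere with
weight at least `l_b(H_b + 1)` against a signal of at most `l_b(H_b) T`, which gives the second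
term. -/
lemma fadeSum_near_le {j₀ : ℕ} {ω : Ω} (hω : D.serving p s ω = .inl j₀) {gam T : ℝ}
    (hgam : 0 < gam) (hT : 0 ≤ T) (hfade : D.fadeB j₀ ω ≤ T)
    (hS : ENNReal.ofReal gam < D.SINR p s ω) :
    D.fadeSum {y | Params.linkLength p.Hb y ≤ p.Hb + 1} ω ≤
      ENNReal.ofReal (T + nearRatio p s * T / gam) := by
  classical
  have h1 := mul_tsum_le_of_lt_SINR hS
  rw [hω] at h1
  set f₁ := p.avgPower s .b (p.Hb + 1) with hf₁
  have hf₁0 : 0 < f₁ := p.avgPower_pos s .b (by linarith [p.Hb_pos])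
  have hanti := (p.avgPower_strictAntiOn s .b).antitoneOn
  set A : Set Plane := {y | Params.linkLength p.Hb y ≤ p.Hb + 1} with hA
  let I : ℝ≥0∞ := ∑' j, if (j ≠ j₀ ∧ D.posB j ω ∈ A) then ENNReal.ofReal (D.fadeB j ω) else 0
  have hI : D.fadeSum A ω ≤ ENNReal.ofReal T + I := by
    have h2 : D.fadeSum A ω ≤ ∑' j, ((if j = j₀ then ENNReal.ofReal T else 0) +
        if (j ≠ j₀ ∧ D.posB j ω ∈ A) then ENNReal.ofReal (D.fadeB j ω) else 0) := by
      refine ENNReal.tsum_le_tsum fun j => ?_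
      by_cases hj : j = j₀
      · subst hj
        by_cases hjA : D.posB j ω ∈ A
        · simpa [hjA] using ENNReal.ofReal_le_ofReal hfade
        · simp [hjA]
      · simp [hj]
    rwa [ENNReal.tsum_add, tsum_ite_eq] at h2
  have h3 : ENNReal.ofReal f₁ * I ≤ ∑' j, (if (Sum.inl j : Tx) ≠ .inl j₀ then ENNReal.ofReal
      (p.avgPower s .b (Params.linkLength p.Hb (D.posB j ω)) * D.fadeB j ω) else 0) := by
    rw [← ENNReal.tsum_mul_left]
    refine ENNReal.tsum_le_tsum fun j => ?_
    by_cases hj : j = j₀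
    · simp [hj]
    · by_cases hjA : D.posB j ω ∈ A
      · have h4 : f₁ ≤ p.avgPower s .b (Params.linkLength p.Hb (D.posB j ω)) :=
          hanti (Params.le_linkLength p.Hb _)
            (le_add_of_nonneg_right zero_le_one : p.Hb ≤ p.Hb + 1) hjA
        rw [if_pos ⟨hj, hjA⟩, if_pos (by simpa using hj),
          ENNReal.ofReal_mul (hf₁0.le.trans h4)]
        gcongr
      · simp [hjA]
  have h5 : D.rxPower p s (.inl j₀) ω * D.fading p (.inl j₀) ω ≤ p.avgPower s .b p.Hb * T := by
    have hb : D.rxPower p s (.inl j₀) ω ≤ p.avgPower s .b p.Hb :=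
      hanti (le_refl p.Hb : p.alt .b ≤ p.Hb) (Params.le_linkLength p.Hb (D.posB j₀ ω))
        (Params.le_linkLength p.Hb (D.posB j₀ ω))
    have hb0 : 0 < D.rxPower p s (.inl j₀) ω :=
      p.avgPower_pos s _ (p.Hb_pos.trans_le (Params.le_linkLength p.Hb (D.posB j₀ ω)))
    calc D.rxPower p s (.inl j₀) ω * D.fading p (.inl j₀) ω
        ≤ D.rxPower p s (.inl j₀) ω * T := mul_le_mul_of_nonneg_left hfade hb0.le
      _ ≤ _ := mul_le_mul_of_nonneg_right hb hT
  have h6 : I * ENNReal.ofReal (gam * f₁) ≤ ENNReal.ofReal (p.avgPower s .b p.Hb * T) := by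
    calc _ = ENNReal.ofReal gam * (ENNReal.ofReal f₁ * I) := by
          rw [ENNReal.ofReal_mul hgam.le]
          ring
      _ ≤ _ := mul_le_mul_right h3 _
      _ ≤ _ := h1
      _ ≤ _ := ENNReal.ofReal_le_ofReal h5
  have h7 : 0 < gam * f₁ := by positivity
  rw [← ENNReal.le_div_iff_mul_le (Or.inl (by simpa using h7)) (Or.inl ENNReal.ofReal_ne_top),
    ← ENNReal.ofReal_div_of_pos h7] at h6
  have hn := nearRatio_pos p s
  rw [ENNReal.ofReal_add hT (by positivity)]
  refine hI.trans (add_le_add_right (h6.trans_eq ?_) _)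
  congr 1
  rw [nearRatio, ← hf₁]
  field_simp

/-- The signal is at most `r T`, while a TBS in the annulus interferes with weight at least `c r`;
the power `r` cancels, so the bound is uniform in it. -/
lemma fadeSum_annulus_le {k : Tier} {i : ℕ} {ω : Ω} (hω : ω ∈ D.servedBy p s k (.inr i))
    {gam c T : ℝ} (hgam : 0 < gam) (hc : 0 < c)
    (hfade : D.mark (.fade k) (.inr i) ω ≤ T) (hS : ENNReal.ofReal gam < D.SINR p s ω) :
    D.fadeSum (annulus p s c (D.rxPower p s (.inr i) ω)) ω ≤ ENNReal.ofReal (T / (gam * c)) := by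
  classical
  have hr := rxPower_inr_pos (D := D) (p := p) (s := s) i ω
  set r := D.rxPower p s (.inr i) ω with hrdef
  have h1 := mul_tsum_le_of_lt_SINR hS
  have hserv : D.serving p s ω = .inr i := hω.1
  have hfad : D.fading p (.inr i) ω ≤ T := by
    unfold fading
    rw [show D.tier p (.inr i) ω = k from hω.2]
    exact hfade
  rw [hserv] at h1
  have h2 : ENNReal.ofReal (c * r) * D.fadeSum (annulus p s c r) ω ≤
      ∑' j, (if (Sum.inl j : Tx) ≠ .inr i then ENNReal.ofReal
      (p.avgPower s .b (Params.linkLength p.Hb (D.posB j ω)) * D.fadeB j ω) else 0) := by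
    unfold fadeSum
    rw [← ENNReal.tsum_mul_left]
    refine ENNReal.tsum_le_tsum fun j => ?_
    have hne : (Sum.inl j : Tx) ≠ .inr i := by simp
    rw [if_pos hne]
    split_ifs with hj
    · rw [ENNReal.ofReal_mul ((mul_pos hc hr).le.trans hj.1)]
      gcongr
      exact hj.1
    · simp
  have h3 : D.fadeSum (annulus p s c r) ω * ENNReal.ofReal (gam * (c * r)) ≤
      ENNReal.ofReal (r * T) := by
    calc _ = ENNReal.ofReal gam *
          (ENNReal.ofReal (c * r) * D.fadeSum (annulus p s c r) ω) := by
          rw [ENNReal.ofReal_mul hgam.le]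
          ring
      _ ≤ _ := mul_le_mul_right h2 _
      _ ≤ _ := h1
      _ ≤ _ := ENNReal.ofReal_le_ofReal (mul_le_mul_of_nonneg_left hfad hr.le)
  have h4 : 0 < gam * (c * r) := by positivity
  rw [← ENNReal.le_div_iff_mul_le (Or.inl (by simpa using h4)) (Or.inl ENNReal.ofReal_ne_top),
    ← ENNReal.ofReal_div_of_pos h4] at h3
  refine h3.trans_eq ?_
  congr 1
  field_simp

variable [MeasurableSpace Ω] {P : Measure Ω} {lamB : ℝ}

lemma IsModel.measurableSet_servedBy (h : D.IsModel p s P lamB) (k : Tier) (x : Tx) :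
    MeasurableSet (D.servedBy p s k x) :=
  Network.measurableSet_servedBy h.measurable_posB h.measurable_posU
    (fun _ => h.measurable_mark _ _) k x

lemma IsModel.measurableSet_assocEvent (h : D.IsModel p s P lamB) (k : Tier) :
    MeasurableSet (D.assocEvent p s k) :=
  Network.measurableSet_assocEvent h.measurable_posB h.measurable_posU
    (fun _ => h.measurable_mark _ _) k

lemma IsModel.tsum_measure_servedBy (h : D.IsModel p s P lamB) (k : Tier) :
    ∑' x, P (D.servedBy p s k x) = P (D.assocEvent p s k) := by
  rw [assocEvent_eq_iUnion, measure_iUnion (pairwise_disjoint_servedBy k)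
    (h.measurableSet_servedBy k)]

/-- The fading gain of the serving link is independent of the association. -/
lemma IsModel.measure_servedBy_inter_fade [IsProbabilityMeasure P] (h : D.IsModel p s P lamB)
    (k : Tier) (x : Tx) (T : ℝ) :
    P (D.servedBy p s k x ∩ {ω | T < D.mark (.fade k) x ω}) =
      P (D.servedBy p s k x) * gammaMeasure (p.M k) (p.M k) (Set.Ioi T) := by
  have hS : MeasurableSet[D.infoAlg geometrySources] (D.servedBy p s k x) := by
    let _ := D.infoAlg geometrySources
    exact Network.measurableSet_servedBy
      (fun i => measurable_posB_infoAlg (Or.inl ⟨_, rfl⟩) i)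
      (fun i => measurable_posU_infoAlg (Or.inl ⟨_, rfl⟩) i)
      (fun i => measurable_mark_infoAlg (Or.inr ⟨i, rfl⟩)) k x
  -- The tier `k` is fixed in advance, so the fading is a single mark, and fading marks are not
  -- among the sources that determine the association.
  have hT : MeasurableSet[D.infoAlg geometrySourcesᶜ] {ω | T < D.mark (.fade k) x ω} :=
    measurable_mark_infoAlg (by simp [geometrySources]) measurableSet_Ioi
  rw [(Indep_iff _ _ _).1 (h.indep_infoAlg disjoint_compl_right) _ _ hS hT, ← h.fade_law k x,
    Measure.map_apply (h.measurable_mark _ _) measurableSet_Ioi]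
  rfl

/-- Coverage by the `i`-th UAV is unlikely, uniformly with respect to the association. -/
lemma IsModel.measure_servedBy_inr_inter_le [IsProbabilityMeasure P] (h : D.IsModel p s P lamB)
    {k : Tier} (hk : k ≠ .b) (i : ℕ) {gam c T : ℝ} (hgam : 0 < gam) (hc : 0 < c) (hT : 0 ≤ T)
    (hvol : ∀ r, 0 < r → r ≤ p.avgPower s k p.Hu →
      ENNReal.ofReal Real.pi ≤ volume (annulus p s c r)) :
    P (D.servedBy p s k (.inr i) ∩ {ω | ENNReal.ofReal gam < D.SINR p s ω}) ≤
      (gammaMeasure (p.M k) (p.M k) (Set.Ioi T) +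
        ENNReal.ofReal (Real.exp (T / (gam * c))) * decay lamB) *
      P (D.servedBy p s k (.inr i)) := by
  -- `w` encodes both the event and the power: it is positive exactly when UAV `i` is the first
  -- strongest one and has tier `k`. It depends on `uavSources` only, hence is independent of the
  -- TBSs and their fading.
  let w : Ω → ℝ := (D.bestUAV p s k i).indicator (D.rxPower p s (.inr i))
  have hwm : Measurable[D.infoAlg uavSources] w := by
    let _ := D.infoAlg uavSources
    have hU := fun i => measurable_posU_infoAlg (D := D) (S := uavSources) (Or.inl rfl) i
    have hl : ∀ i, Measurable (D.mark .losU (.inr i)) :=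
      fun i => measurable_mark_infoAlg (D := D) (S := uavSources) (Or.inr ⟨i, rfl⟩)
    exact (measurable_rxPower_inr (hU i) (hl i)).indicator (measurableSet_bestUAV hU hl k i)
  have hind := h.indepFun (S := uavSources) (T := uavSourcesᶜ) disjoint_compl_right hwm
    (measurable_tbs_infoAlg (by
      rintro _ (rfl | ⟨j, rfl⟩) <;> simp [uavSources]))
  have hw0 : ∀ ω, 0 < w ω → ω ∈ D.bestUAV p s k i := fun ω hω => by
    by_contra hn
    simp only [w, Set.indicator_of_notMem hn, lt_self_iff_false] at hω
  have hwr : ∀ ω, ω ∈ D.bestUAV p s k i → w ω = D.rxPower p s (.inr i) ω := fun ω hω =>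
    Set.indicator_of_mem hω _
  have halt : p.alt k = p.Hu := by cases k <;> first | rfl | exact absurd rfl hk
  have key := h.measure_fadeSum_annulus_le (hwm.mono (h.infoAlg_le _) le_rfl) hind hc
    (a := T / (gam * c)) (by positivity) fun ω hω => by
      refine hvol _ hω ?_
      rw [hwr ω (hw0 ω hω)]
      unfold rxPower
      rw [show D.tier p (.inr i) ω = k from (hw0 ω hω).1]
      have := (p.avgPower_strictAntiOn s k).antitoneOn (a := p.Hu) (b := D.dist p (.inr i) ω)
      rw [halt] at this
      exact this (le_refl p.Hu) (Params.le_linkLength p.Hu (D.posU i ω))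
        (Params.le_linkLength p.Hu (D.posU i ω))
  calc _ ≤ P ((D.servedBy p s k (.inr i) ∩ {ω | T < D.mark (.fade k) (.inr i) ω}) ∪
        {ω | 0 < w ω ∧ (∀ j, D.rxPower p s (.inl j) ω ≤ w ω) ∧
          D.fadeSum (annulus p s c (w ω)) ω ≤ ENNReal.ofReal (T / (gam * c))}) := by
        refine measure_mono fun ω hω => ?_
        obtain ⟨hω1, hω2⟩ := hω
        by_cases hfade : T < D.mark (.fade k) (.inr i) ω
        · exact Or.inl ⟨hω1, hfade⟩
        right
        obtain ⟨hb, hB⟩ := servedBy_inr_subset k i hω1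
        rw [Set.mem_ofPred, hwr ω hb]
        exact ⟨rxPower_inr_pos i ω, hB,
          fadeSum_annulus_le hω1 hgam hc (not_lt.1 hfade) hω2⟩
    _ ≤ P (D.servedBy p s k (.inr i)) * gammaMeasure (p.M k) (p.M k) (Set.Ioi T) +
        ENNReal.ofReal (Real.exp (T / (gam * c))) * decay lamB *
          P {ω | 0 < w ω ∧ ∀ j, D.rxPower p s (.inl j) ω < w ω} := by
        refine (measure_union_le _ _).trans (add_le_add ?_ key)
        rw [h.measure_servedBy_inter_fade]
    _ ≤ P (D.servedBy p s k (.inr i)) * gammaMeasure (p.M k) (p.M k) (Set.Ioi T) +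
        ENNReal.ofReal (Real.exp (T / (gam * c))) * decay lamB *
          P (D.servedBy p s k (.inr i)) := by
        -- If the best UAV beats every TBS strictly, it serves the user; this makes the whole bound
        -- proportional to the probability of service by UAV `i`.
        gcongr
        rintro ω ⟨hω1, hω2⟩
        refine subset_servedBy_inr k i ⟨hw0 ω hω1, ?_⟩
        rwa [hwr ω (hw0 ω hω1)] at hω2
    _ = _ := by ring

/-- Coverage by a UAV is unlikely, uniformly with respect to the association. -/
lemma IsModel.measure_assocEvent_uav_inter_le [IsProbabilityMeasure P]
    (h : D.IsModel p s P lamB) {k : Tier} (hk : k ≠ .b) {gam c T : ℝ} (hgam : 0 < gam)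
    (hc : 0 < c) (hT : 0 ≤ T) (hvol : ∀ r, 0 < r → r ≤ p.avgPower s k p.Hu →
      ENNReal.ofReal Real.pi ≤ volume (annulus p s c r)) :
    P (D.assocEvent p s k ∩ {ω | ENNReal.ofReal gam < D.SINR p s ω}) ≤
      (gammaMeasure (p.M k) (p.M k) (Set.Ioi T) +
        ENNReal.ofReal (Real.exp (T / (gam * c))) * decay lamB) * P (D.assocEvent p s k) := by
  rw [← h.tsum_measure_servedBy, ← ENNReal.tsum_mul_left, assocEvent_eq_iUnion, Set.iUnion_inter]
  refine (measure_iUnion_le _).trans (ENNReal.tsum_le_tsum fun x => ?_)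
  rcases x with j | i
  · have : D.servedBy p s k (.inl j) = ∅ := by
      ext ω
      simp [servedBy, tier, hk.symm]
    simp [this]
  · exact h.measure_servedBy_inr_inter_le hk i hgam hc hT hvol

/-- Coverage by a TBS is unlikely. -/
lemma IsModel.measure_assocEvent_b_inter_le [IsProbabilityMeasure P]
    (h : D.IsModel p s P lamB) {gam T : ℝ} (hgam : 0 < gam) (hT : 0 ≤ T) :
    P (D.assocEvent p s .b ∩ {ω | ENNReal.ofReal gam < D.SINR p s ω}) ≤
      gammaMeasure (p.M .b) (p.M .b) (Set.Ioi T) +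
        ENNReal.ofReal (Real.exp (T + nearRatio p s * T / gam)) * decay lamB := by
  set A : Set Plane := {y | Params.linkLength p.Hb y ≤ p.Hb + 1} with hA
  have hHb := p.Hb_pos
  have hn := nearRatio_pos p s
  have hvol : volume A = ENNReal.ofReal (((p.Hb + 1) ^ 2 - p.Hb ^ 2) * Real.pi) :=
    Params.volume_linkLength_le hHb.le (by linarith)
  have h1 := h.measure_fadeSum_le (A := A)
    (measurableSet_le (Params.measurable_linkLength _) measurable_const)
    (by rw [hvol]; exact ENNReal.ofReal_ne_top)
    (by
      rw [hvol]
      refine ENNReal.ofReal_le_ofReal ?_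
      nlinarith [mul_pos hHb Real.pi_pos])
    (c := T + nearRatio p s * T / gam) (by positivity)
  calc _ ≤ P ((⋃ x, D.servedBy p s .b x ∩ {ω | T < D.mark (.fade .b) x ω}) ∪
        {ω | D.fadeSum A ω ≤ ENNReal.ofReal (T + nearRatio p s * T / gam)}) := by
        refine measure_mono fun ω hω => ?_
        obtain ⟨hω1, hω2⟩ := hω
        obtain ⟨j, hj⟩ := (tier_eq_b_iff _ ω).1 hω1
        by_cases hfade : T < D.mark (.fade .b) (.inl j) ω
        · exact Or.inl (Set.mem_iUnion.2 ⟨.inl j, ⟨hj, (tier_eq_b_iff _ ω).2 ⟨j, rfl⟩⟩, hfade⟩)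
        · exact Or.inr (fadeSum_near_le hj hgam hT (not_lt.1 hfade) hω2)
    _ ≤ _ := by
        refine (measure_union_le _ _).trans (add_le_add ?_ h1)
        refine (measure_iUnion_le _).trans ?_
        simp_rw [h.measure_servedBy_inter_fade]
        rw [ENNReal.tsum_mul_right, h.tsum_measure_servedBy]
        exact mul_le_of_le_one_left' prob_le_one

/-! ### Dense limit of the coverage probability and of its moments -/

lemma tendsto_decay : Tendsto decay atTop (𝓝 0) := by
  refine tendsto_negExp_ofReal_mul (mul_ne_zero ?_ ?_)
  · exact (tsub_pos_of_lt (laplaceOne_gammaMeasure_lt_one one_pos one_pos)).ne'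
  · simpa using Real.pi_pos

lemma exists_measure_Ioi_lt (μ : Measure ℝ) [IsFiniteMeasure μ] {ε : ℝ≥0∞} (hε : 0 < ε) :
    ∃ T, 0 ≤ T ∧ μ (Set.Ioi T) < ε := by
  have h1 : Tendsto (fun n : ℕ => μ (Set.Ioi (n : ℝ))) atTop (𝓝 (μ (⋂ n : ℕ, Set.Ioi (n : ℝ)))) :=
    tendsto_measure_iInter_atTop (fun n => measurableSet_Ioi.nullMeasurableSet)
      (fun m n hmn => Set.Ioi_subset_Ioi (by exact_mod_cast hmn)) ⟨0, measure_ne_top _ _⟩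
  have h2 : ⋂ n : ℕ, Set.Ioi (n : ℝ) = ∅ := by
    ext x
    obtain ⟨n, hn⟩ := exists_nat_ge x
    simp only [Set.mem_iInter, Set.mem_Ioi, Set.mem_empty_iff_false, iff_false, not_forall]
    exact ⟨n, not_lt.2 hn⟩
  rw [h2, measure_empty] at h1
  obtain ⟨n, hn⟩ := (h1.eventually (gt_mem_nhds hε)).exists
  exact ⟨n, n.cast_nonneg, hn⟩

lemma eventually_add_mul_decay_lt {a ε C : ℝ≥0∞} (ha : a < ε) (hC : C ≠ ∞) :
    ∀ᶠ lamB in atTop, a + C * decay lamB < ε := by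
  have h := (ENNReal.Tendsto.const_mul tendsto_decay (Or.inr hC)).const_add a
  rw [mul_zero, add_zero] at h
  exact h.eventually (gt_mem_nhds ha)

/-- Given the tier of the serving transmitter, coverage becomes unlikely in the limit of dense
TBSs. -/
lemma eventually_measure_assocEvent_inter_le (p : Params) (s : Antenna) {Ω : ℝ → Type*}
    [∀ lamB, MeasurableSpace (Ω lamB)] (P : ∀ lamB, Measure (Ω lamB))
    [∀ lamB, IsProbabilityMeasure (P lamB)] (D : ∀ lamB, Network (Ω lamB))
    (hD : ∀ lamB, 0 < lamB → (D lamB).IsModel p s (P lamB) lamB) {gam : ℝ} (hgam : 0 < gam)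
    (k : Tier) {ε : ℝ≥0∞} (hε : 0 < ε) :
    ∀ᶠ lamB in atTop, P lamB ((D lamB).assocEvent p s k ∩
      {ω | ENNReal.ofReal gam < (D lamB).SINR p s ω}) ≤
        ε * P lamB ((D lamB).assocEvent p s k) := by
  have := isProbabilityMeasure_gammaMeasure (p.M_pos k) (p.M_pos k)
  by_cases hk : k = .b
  · subst hk
    -- `A_b` eventually exceeds some `v > 0`, so the absolute bound suffices once the fading tail
    -- beyond `T` is below `ε v`.
    have hV : 0 < ENNReal.ofReal (p.limitAssocProb s) := by
      simpa using p.limitAssocProb_pos s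
    obtain ⟨v, hv0, hv⟩ := exists_between hV
    obtain ⟨T, hT, hTε⟩ := exists_measure_Ioi_lt (gammaMeasure (p.M .b) (p.M .b))
      (ENNReal.mul_pos hε.ne' hv0.ne')
    filter_upwards [eventually_gt_atTop 0, (tendsto_measure_assocEvent_b p s P D hD).eventually
      (lt_mem_nhds hv), eventually_add_mul_decay_lt hTε
      (C := ENNReal.ofReal (Real.exp (T + nearRatio p s * T / gam))) ENNReal.ofReal_ne_top]
      with lamB h0 h1 h2
    refine ((hD lamB h0).measure_assocEvent_b_inter_le hgam hT).trans (h2.le.trans ?_)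
    gcongr
  -- Here `A_k` may vanish in the limit and the relative bound is needed. No UAV of tier `k` exceeds
  -- `l_k(H_u)`, so one `c` serves all powers.
  · obtain ⟨c, hc, hvol⟩ := p.exists_volume_annulus s .b
      (p.avgPower_pos s k p.Hu_pos)
    obtain ⟨T, hT, hTε⟩ := exists_measure_Ioi_lt (gammaMeasure (p.M k) (p.M k)) hε
    filter_upwards [eventually_gt_atTop 0, eventually_add_mul_decay_lt hTε
      (C := ENNReal.ofReal (Real.exp (T / (gam * c)))) ENNReal.ofReal_ne_top] with lamB h0 h2
    refine ((hD lamB h0).measure_assocEvent_uav_inter_le hk hgam hc hT hvol).trans ?_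
    gcongr

/-- The moments of the conditional success probability vanish in the limit of dense TBSs. -/
theorem tendsto_condMoment (p : Params) (s : Antenna) {Ω : ℝ → Type*}
    [∀ lamB, MeasurableSpace (Ω lamB)] (P : ∀ lamB, Measure (Ω lamB))
    [∀ lamB, IsProbabilityMeasure (P lamB)] (D : ∀ lamB, Network (Ω lamB))
    (hD : ∀ lamB, 0 < lamB → (D lamB).IsModel p s (P lamB) lamB) {gam : ℝ} (hgam : 0 < gam)
    {n : ℕ} (hn : 1 ≤ n) (k : Tier) :
    Tendsto (fun lamB => (D lamB).condMoment p s (P lamB) k gam n) atTop (𝓝 0) := by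
  refine tendsto_order.2 ⟨fun a ha => Eventually.of_forall fun lamB =>
    ha.trans_le (integral_condExp_indicator_pow_le _ hn).1, fun a ha => ?_⟩
  obtain ⟨ε, hε0, hεa⟩ := exists_between ha
  filter_upwards [eventually_measure_assocEvent_inter_le p s P D hD hgam k
    (ENNReal.ofReal_pos.2 hε0), eventually_gt_atTop 0] with lamB h1 h0
  refine (integral_condExp_indicator_pow_le _ hn).2.trans_lt (lt_of_le_of_lt ?_ hεa)
  rw [measureReal_def]
  refine ENNReal.toReal_le_of_le_ofReal hε0.le ?_
  rw [cond_apply ((hD lamB h0).measurableSet_assocEvent k)]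
  rw [mul_comm, ← div_eq_mul_inv]
  exact ENNReal.div_le_of_le_mul h1

end Network

end UAVNet

end

theorem corollary3 (p : UAVNet.Params) (s : UAVNet.Antenna)
    {Ω : ℝ → Type*} [∀ lamB, MeasurableSpace (Ω lamB)]
    (P : ∀ lamB, Measure (Ω lamB)) [∀ lamB, IsProbabilityMeasure (P lamB)]
    (D : ∀ lamB, UAVNet.Network (Ω lamB))
    (hD : ∀ lamB, 0 < lamB → (D lamB).IsModel p s (P lamB) lamB) :
    Tendsto (fun lamB => (D lamB).assocProb p s (P lamB) .b) atTop
      (𝓝 (Real.exp (-(2 * Real.pi * p.lamU *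
        ((∫ x in p.Hu..p.chi s .b .L p.Hb, p.pL x * x) +
          ∫ x in p.Hu..p.chi s .b .N p.Hb, p.pN x * x))))) ∧
    (∀ gam : ℝ, 0 < gam → ∀ n : ℕ, 1 ≤ n → ∀ k : UAVNet.Tier,
      Tendsto (fun lamB => (D lamB).condMoment p s (P lamB) k gam n) atTop (𝓝 0)) ∧
    (p.kap .N * p.Hu ^ (-p.al .N) ≤ p.kap .L * p.Hu ^ (-p.al .L) →
      p.Pu * p.GMu * p.kap .L * p.Hu ^ (-p.al .L) ≤ p.Pb * p.GMb * p.kap .b * p.Hb ^ (-p.al .b) →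
      Tendsto (fun lamB => (D lamB).assocProb p s (P lamB) .b) atTop (𝓝 1)) := by
  have h := UAVNet.Network.tendsto_assocProb_b p s P D hD
  refine ⟨h, fun gam hgam n hn k => UAVNet.Network.tendsto_condMoment p s P D hD hgam hn k,
    fun hNL hLb => ?_⟩
  rwa [p.limitAssocProb_eq_one s hNL hLb] at h
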